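/- **Conventions.** Fix a separable infinite-dimensional complex Hilbert space $L$ and a unitary isomorphism $\iota : L \to L\dot\otimes L$, where $\dot\otimes$ denotes the Hilbert tensor product of Hilbert spaces, and also the Hilbert tensor product of bounded operators. Put $\mathcal B=\mathcal B(L)$, let $\mathcal K=\mathcal K(L)$ be the compact operators, and write $a\diamond b=\iota^*(a\dot\otimes b)\iota$. For a complex linear space $E$ let $\mathcal KE=\mathcal K\otimes E$ (algebraic tensor product), a $\mathcal B$-bimodule via $b\cdot(a\otimes x)\cdot c=(bac)\otimes x$. A *quantum norm* on $E$ is a norm on $\mathcal KE$ such that (RI) $\|b\cdot u\|,\|u\cdot b\|\le\|b\|\,\|u\|$ for $b\in\mathcal B$, $u\in\mathcal KE$; and (RII) $\|u+v\|=\max\{\|u\|,\|v\|\}$ whenever there are orthogonal projections $P,Q\in\mathcal B$ with $PQ=0$, $P\cdot u=u=u\cdot P$ and $Q\cdot v=v=v\cdot Q$. A linear isomorphism $\varphi:E\to F$ of spaces with quantum norms (quantum spaces) is a *completely isometric isomorphism* if $\mathbf 1_{\mathcal K}\otimes\varphi:\mathcal KE\to\mathcal KF$ is isometric. An injective linear map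 $I:E\to\mathcal B(H_1,K_1)$, with $H_1,K_1$ Hilbert spaces, gives the *concrete* quantum norm $\|u\|=\|J(u)\|$ on $E$, where $J:\mathcal KE\to\mathcal B(L\dot\otimes H_1,L\dot\otimes K_1)$ is linear with $J(a\otimes x)=a\dot\otimes I(x)$. For a Hilbert space $H$ with complex-conjugate space $\overline H$, the column space $H_c$ and the row space $H_r$ are $H$ with the concrete quantum norms given by $I_c:H\to\mathcal B(\mathbb C,H)$, $I_c(x)(1)=x$, and $I_r:H\to\mathcal B(\overline H,\mathbb C)$, $I_r(x)(y)=\langle x,y\rangle$ (linear in $x$). For quantum spaces $E,F$, the quantum spaces $E\otimes_hF$ and $E\otimes_4F$ are the algebraic tensor product $E\otimes F$ with, for $U\in\mathcal K(E\otimes F)$, $$\|U\|_h=\inf\Big\{\sum_{k=1}^n\|u_k\|\|v_k\| : U=\sum_{k=1}^n u_k\odot v_k\Big\},$$ $$\|U\|_4=\inf\Big\{\sum_{k=1}^n\|a_k\|\|u_k\|\|v_k\|\|b_k\| : U=\sum_{k=1}^n a_k\cdot(u_k\diamond v_k)\cdot b_k\Big\},$$ where $n\ge0$, $u_k\in\mathcal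 KE$, $v_k\in\mathcal KF$, $a_k,b_k\in\mathcal K$, and $\odot,\diamond:\mathcal KE\times\mathcal KF\to\mathcal K(E\otimes F)$ are bilinear with $(a\otimes x)\odot(b\otimes y)=ab\otimes(x\otimes y)$ and $(a\otimes x)\diamond(b\otimes y)=(a\diamond b)\otimes(x\otimes y)$. If $E,F$ carry the concrete quantum norms given by $I:E\to\mathcal B(H_1,K_1)$ and $J:F\to\mathcal B(H_2,K_2)$, then $E\otimes_{sp}F$ is $E\otimes F$ with the concrete quantum norm given by $x\otimes y\mapsto I(x)\dot\otimes J(y)\in\mathcal B(H_1\dot\otimes H_2,K_1\dot\otimes K_2)$. Finally, $(H\otimes H)_c$ and $(H\otimes H)_r$ denote the algebraic tensor square $H\otimes H$ with the quantum norm obtained by restriction from $(H\dot\otimes H)_c$ and $(H\dot\otimes H)_r$ respectively. **Proposition 29.** Let $H$ be a complex Hilbert space. Then $H_c\otimes_4H_c$, $H_c\otimes_hH_c$, $H_c\otimes_{sp}H_c$ and $(H\otimes H)_c$ are quantum spaces, and the identity map of $H\otimes H$ is a completely isometric isomorphism between any two of them: $$H_c\otimes_4H_c=H_c\otimes_hH_c=H_c\otimes_{sp}H_c=(H\otimes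 H)_c .$$ Likewise $H_r\otimes_4H_r$, $H_r\otimes_hH_r$, $H_r\otimes_{sp}H_r$ and $(H\otimes H)_r$ are quantum spaces, and the identity map of $H\otimes H$ is a completely isometric isomorphism between any two of them: $$H_r\otimes_4H_r=H_r\otimes_hH_r=H_r\otimes_{sp}H_r=(H\otimes H)_r .$$ -/

import Mathlib

open scoped TensorProduct

namespace QFA

noncomputable section

/-! ### The complex-conjugate Hilbert space -/

/-- The complex-conjugate space of `H`: the same additive group and norm, with
`c • x` in the new space equal to `conj c • x` in `H`, and with the inner product conjugated. -/
def ConjSpace (H : Type*) : Type _ := H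

/-- The identity map of `H`, viewed as a map from `H` to its complex-conjugate space. -/
def toConj {H : Type*} (x : H) : ConjSpace H := x

/-- The identity map of `H`, viewed as a map from the complex-conjugate space to `H`. -/
def ofConj {H : Type*} (x : ConjSpace H) : H := x

instance instNormedAddCommGroupConj {H : Type*} [NormedAddCommGroup H] :
    NormedAddCommGroup (ConjSpace H) :=
  inferInstanceAs (NormedAddCommGroup H)

instance instCompleteSpaceConj {H : Type*} [NormedAddCommGroup H] [CompleteSpace H] :
    CompleteSpace (ConjSpace H) :=
  inferInstanceAs (CompleteSpace H)

/-- The module structure of the complex-conjugate space. -/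
@[reducible]
def conjModule (H : Type*) [NormedAddCommGroup H] [InnerProductSpace ℂ H] :
    Module ℂ (ConjSpace H) where
  smul c x := toConj ((starRingEnd ℂ) c • ofConj x)
  one_smul x := by
    change (starRingEnd ℂ) 1 • ofConj x = ofConj x
    simp
  mul_smul a b x := by
    change (starRingEnd ℂ) (a * b) • ofConj x
      = (starRingEnd ℂ) a • ((starRingEnd ℂ) b • ofConj x)
    rw [map_mul, mul_smul]
  smul_zero a := smul_zero (A := H) ((starRingEnd ℂ) a)
  smul_add a x y := smul_add (A := H) ((starRingEnd ℂ) a) (ofConj x) (ofConj y)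
  add_smul a b x := by
    change (starRingEnd ℂ) (a + b) • ofConj x
      = (starRingEnd ℂ) a • ofConj x + (starRingEnd ℂ) b • ofConj x
    rw [map_add, add_smul]
  zero_smul x := by
    change (starRingEnd ℂ) 0 • ofConj x = (0 : H)
    simp

instance instInnerProductSpaceConj {H : Type*} [NormedAddCommGroup H] [InnerProductSpace ℂ H] :
    InnerProductSpace ℂ (ConjSpace H) where
  toModule := conjModule H
  norm_smul_le c x := by
    change ‖(starRingEnd ℂ) c • ofConj x‖ ≤ ‖c‖ * ‖ofConj x‖
    rw [norm_smul, RCLike.norm_conj]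
  inner x y := inner ℂ (ofConj y) (ofConj x)
  norm_sq_eq_re_inner x := norm_sq_eq_re_inner (𝕜 := ℂ) (ofConj x)
  conj_inner_symm x y := inner_conj_symm (𝕜 := ℂ) (ofConj y) (ofConj x)
  add_left x y z := inner_add_right (𝕜 := ℂ) (ofConj z) (ofConj x) (ofConj y)
  smul_left x y c := inner_smul_right (𝕜 := ℂ) (ofConj y) (ofConj x) ((starRingEnd ℂ) c)

/-! ### Hilbert tensor products of Hilbert spaces and of bounded operators -/

/-- The Hilbert tensor product of two Hilbert spaces: the completion of the algebraic tensor
product with `⟪x ⊗ y, x' ⊗ y'⟫ = ⟪x, x'⟫ * ⟪y, y'⟫`. -/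
def HTensor (H K : Type*) [NormedAddCommGroup H] [InnerProductSpace ℂ H]
    [NormedAddCommGroup K] [InnerProductSpace ℂ K] : Type _ :=
  UniformSpace.Completion (H ⊗[ℂ] K)

section HTensorInstances

variable {H K : Type*} [NormedAddCommGroup H] [InnerProductSpace ℂ H]
  [NormedAddCommGroup K] [InnerProductSpace ℂ K]

instance instNormedAddCommGroupHTensor : NormedAddCommGroup (HTensor H K) :=
  inferInstanceAs (NormedAddCommGroup (UniformSpace.Completion (H ⊗[ℂ] K)))

instance instInnerProductSpaceHTensor : InnerProductSpace ℂ (HTensor H K) :=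
  inferInstanceAs (InnerProductSpace ℂ (UniformSpace.Completion (H ⊗[ℂ] K)))

instance instCompleteSpaceHTensor : CompleteSpace (HTensor H K) :=
  inferInstanceAs (CompleteSpace (UniformSpace.Completion (H ⊗[ℂ] K)))

/-- The inclusion of the algebraic tensor product in the Hilbert tensor product. -/
def toHTensor : H ⊗[ℂ] K →ₗ[ℂ] HTensor H K where
  toFun z := (z : UniformSpace.Completion (H ⊗[ℂ] K))
  map_add' z w := UniformSpace.Completion.coe_add z w
  map_smul' c z := UniformSpace.Completion.coe_smul c z

theorem norm_toHTensor (z : H ⊗[ℂ] K) : ‖toHTensor z‖ = ‖z‖ :=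
  UniformSpace.Completion.norm_coe z

theorem inner_toHTensor (z w : H ⊗[ℂ] K) :
    inner ℂ (toHTensor z) (toHTensor w) = inner ℂ z w :=
  UniformSpace.Completion.inner_coe z w

theorem denseRange_toHTensor : DenseRange (toHTensor : H ⊗[ℂ] K → HTensor H K) :=
  UniformSpace.Completion.denseRange_coe

/-- The extension by continuity of a bounded operator on the algebraic tensor product. -/
def liftHTensor {G : Type*} [NormedAddCommGroup G] [NormedSpace ℂ G] [CompleteSpace G]
    (f : H ⊗[ℂ] K →ₗ[ℂ] G) (C : ℝ) (hf : ∀ z, ‖f z‖ ≤ C * ‖z‖) : HTensor H K →L[ℂ] G :=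
  ContinuousLinearMap.fromCompletion (f.mkContinuous C hf)

theorem liftHTensor_apply {G : Type*} [NormedAddCommGroup G] [NormedSpace ℂ G] [CompleteSpace G]
    (f : H ⊗[ℂ] K →ₗ[ℂ] G) (C : ℝ) (hf : ∀ z, ‖f z‖ ≤ C * ‖z‖) (z : H ⊗[ℂ] K) :
    liftHTensor f C hf (toHTensor z) = f z :=
  ContinuousLinearMap.fromCompletion_apply_coe (f.mkContinuous C hf) z

theorem htensor_ext {G : Type*} [NormedAddCommGroup G] [NormedSpace ℂ G]
    {f g : HTensor H K →L[ℂ] G}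
    (h : ∀ z : H ⊗[ℂ] K, f (toHTensor z) = g (toHTensor z)) : f = g :=
  ContinuousLinearMap.coeFn_injective
    (denseRange_toHTensor.equalizer f.continuous g.continuous (funext h))

end HTensorInstances

section HMap

variable {H₁ K₁ H₂ K₂ : Type*}
  [NormedAddCommGroup H₁] [InnerProductSpace ℂ H₁] [NormedAddCommGroup K₁] [InnerProductSpace ℂ K₁]
  [NormedAddCommGroup H₂] [InnerProductSpace ℂ H₂] [NormedAddCommGroup K₂] [InnerProductSpace ℂ K₂]

theorem norm_map_le (a : H₁ →L[ℂ] K₁) (b : H₂ →L[ℂ] K₂) (z : H₁ ⊗[ℂ] H₂) :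
    ‖TensorProduct.map (a : H₁ →ₗ[ℂ] K₁) (b : H₂ →ₗ[ℂ] K₂) z‖ ≤ ‖a‖ * ‖b‖ * ‖z‖ := by
  have h := ((TensorProduct.mapL a b).le_opNorm z).trans
    (mul_le_mul_of_nonneg_right (TensorProduct.norm_mapL_le a b) (norm_nonneg z))
  rwa [TensorProduct.mapL_apply] at h

/-- The Hilbert tensor product of two bounded operators: the unique bounded operator with
`x ⊗ y ↦ a x ⊗ b y`. -/
def hmap (a : H₁ →L[ℂ] K₁) (b : H₂ →L[ℂ] K₂) : HTensor H₁ H₂ →L[ℂ] HTensor K₁ K₂ :=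
  liftHTensor (toHTensor ∘ₗ TensorProduct.map (a : H₁ →ₗ[ℂ] K₁) (b : H₂ →ₗ[ℂ] K₂)) (‖a‖ * ‖b‖)
    fun z => (norm_toHTensor _).trans_le (norm_map_le a b z)

theorem hmap_toHTensor (a : H₁ →L[ℂ] K₁) (b : H₂ →L[ℂ] K₂) (z : H₁ ⊗[ℂ] H₂) :
    hmap a b (toHTensor z)
      = toHTensor (TensorProduct.map (a : H₁ →ₗ[ℂ] K₁) (b : H₂ →ₗ[ℂ] K₂) z) :=
  liftHTensor_apply _ _ _ _

theorem hmap_add_left (a a' : H₁ →L[ℂ] K₁) (b : H₂ →L[ℂ] K₂) :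
    hmap (a + a') b = hmap a b + hmap a' b :=
  htensor_ext fun z => by
    simp only [add_apply, hmap_toHTensor, ← map_add]
    rw [← LinearMap.add_apply, ← TensorProduct.map_add_left]
    rfl

theorem hmap_add_right (a : H₁ →L[ℂ] K₁) (b b' : H₂ →L[ℂ] K₂) :
    hmap a (b + b') = hmap a b + hmap a b' :=
  htensor_ext fun z => by
    simp only [add_apply, hmap_toHTensor, ← map_add]
    rw [← LinearMap.add_apply, ← TensorProduct.map_add_right]
    rfl

theorem hmap_smul_left (c : ℂ) (a : H₁ →L[ℂ] K₁) (b : H₂ →L[ℂ] K₂) :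
    hmap (c • a) b = c • hmap a b :=
  htensor_ext fun z => by
    simp only [smul_apply, hmap_toHTensor]
    rw [← map_smul toHTensor, ← LinearMap.smul_apply, ← TensorProduct.map_smul_left]
    rfl

theorem hmap_smul_right (c : ℂ) (a : H₁ →L[ℂ] K₁) (b : H₂ →L[ℂ] K₂) :
    hmap a (c • b) = c • hmap a b :=
  htensor_ext fun z => by
    simp only [smul_apply, hmap_toHTensor]
    rw [← map_smul toHTensor, ← LinearMap.smul_apply, ← TensorProduct.map_smul_right]
    rfl

/-- The Hilbert tensor product of operators, as a bilinear map. -/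
def hmapₗ : (H₁ →L[ℂ] K₁) →ₗ[ℂ] (H₂ →L[ℂ] K₂) →ₗ[ℂ] (HTensor H₁ H₂ →L[ℂ] HTensor K₁ K₂) :=
  LinearMap.mk₂ ℂ hmap hmap_add_left hmap_smul_left hmap_add_right hmap_smul_right

theorem norm_hmap_le (a : H₁ →L[ℂ] K₁) (b : H₂ →L[ℂ] K₂) : ‖hmap a b‖ ≤ ‖a‖ * ‖b‖ := by
  refine ContinuousLinearMap.opNorm_le_bound _ (by positivity) fun x => ?_
  refine denseRange_toHTensor.induction_on x
    (isClosed_le (by fun_prop) (by fun_prop)) fun z => ?_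
  rw [hmap_toHTensor, norm_toHTensor, norm_toHTensor]
  exact norm_map_le a b z

theorem hmap_comp {G₁ G₂ : Type*} [NormedAddCommGroup G₁] [InnerProductSpace ℂ G₁]
    [NormedAddCommGroup G₂] [InnerProductSpace ℂ G₂] (a' : K₁ →L[ℂ] G₁) (b' : K₂ →L[ℂ] G₂)
    (a : H₁ →L[ℂ] K₁) (b : H₂ →L[ℂ] K₂) :
    hmap (a' ∘L a) (b' ∘L b) = hmap a' b' ∘L hmap a b :=
  htensor_ext fun z => by
    rw [ContinuousLinearMap.comp_apply, hmap_toHTensor, hmap_toHTensor, hmap_toHTensor,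
      TensorProduct.map_map]
    rfl

end HMap

/-! ### The Hilbert tensor product of compact operators is compact -/

section Compact

variable {H K : Type*} [NormedAddCommGroup H] [InnerProductSpace ℂ H]
  [NormedAddCommGroup K] [InnerProductSpace ℂ K]

/-- A compact operator into a Hilbert space is approximated by its compressions to
finite-dimensional subspaces. -/
theorem exists_finite_approx {a : H →L[ℂ] K} (ha : IsCompactOperator a) {ε : ℝ} (hε : 0 < ε) :
    ∃ (V : Submodule ℂ K) (_ : FiniteDimensional ℂ V) (a' : H →L[ℂ] V),
      ‖a - V.subtypeL ∘L a'‖ ≤ ε := by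
  have htb : TotallyBounded (a '' Metric.closedBall 0 1) :=
    (IsCompactOperator.isCompact_closure_image_closedBall
      (f := (a : H →ₗ[ℂ] K)) ha 1).totallyBounded.subset subset_closure
  obtain ⟨t, ht, hcov⟩ := Metric.totallyBounded_iff.mp htb ε hε
  have : FiniteDimensional ℂ (Submodule.span ℂ t) := FiniteDimensional.span_of_finite ℂ ht
  refine ⟨Submodule.span ℂ t, inferInstance,
    (Submodule.span ℂ t).orthogonalProjectionOnto ∘L a, ?_⟩
  refine ContinuousLinearMap.opNorm_le_of_unit_norm hε.le fun x hx => ?_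
  have hmem : a x ∈ a '' Metric.closedBall 0 1 := ⟨x, by simp [hx], rfl⟩
  obtain ⟨y, hy, hxy⟩ := Set.mem_iUnion₂.mp (hcov hmem)
  have h1 : ‖a x - (Submodule.span ℂ t).starProjection (a x)‖ ≤ ‖a x - y‖ := by
    rw [Submodule.starProjection_minimal (U := Submodule.span ℂ t) (a x)]
    exact ciInf_le ⟨0, by rintro _ ⟨w, rfl⟩; exact norm_nonneg _⟩
      (⟨y, Submodule.subset_span hy⟩ : Submodule.span ℂ t)
  rw [Metric.mem_ball, dist_eq_norm] at hxy
  exact h1.trans hxy.le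

variable {H₂ K₂ : Type*} [NormedAddCommGroup H₂] [InnerProductSpace ℂ H₂]
  [NormedAddCommGroup K₂] [InnerProductSpace ℂ K₂]

theorem finiteDimensional_htensor (V : Type*) (W : Type*) [NormedAddCommGroup V]
    [InnerProductSpace ℂ V] [NormedAddCommGroup W] [InnerProductSpace ℂ W]
    [FiniteDimensional ℂ V] [FiniteDimensional ℂ W] : FiniteDimensional ℂ (HTensor V W) := by
  refine Module.Finite.of_surjective (toHTensor : V ⊗[ℂ] W →ₗ[ℂ] HTensor V W)
    (LinearMap.range_eq_top.mp ?_)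
  have hcl := (Submodule.closed_of_finiteDimensional
    (LinearMap.range (toHTensor : V ⊗[ℂ] W →ₗ[ℂ] HTensor V W))).closure_eq
  rw [LinearMap.coe_range, denseRange_toHTensor.closure_range] at hcl
  exact SetLike.coe_injective (by rw [LinearMap.coe_range, ← hcl, Submodule.top_coe])

theorem isCompactOperator_hmap_finite (V : Submodule ℂ K) (W : Submodule ℂ K₂)
    [FiniteDimensional ℂ V] [FiniteDimensional ℂ W] (a : H →L[ℂ] V) (b : H₂ →L[ℂ] W) :
    IsCompactOperator (hmap (V.subtypeL ∘L a) (W.subtypeL ∘L b)) := by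
  have := finiteDimensional_htensor V W
  have : ProperSpace (HTensor V W) := FiniteDimensional.proper ℂ _
  have hid : IsCompactOperator (id : HTensor V W → HTensor V W) :=
    ⟨Metric.closedBall 0 1, isCompact_closedBall 0 1, Metric.closedBall_mem_nhds 0 one_pos⟩
  rw [hmap_comp]
  exact (hid.clm_comp (hmap V.subtypeL W.subtypeL)).comp_clm (hmap a b)

theorem isCompactOperator_hmap {a : H →L[ℂ] K} {b : H₂ →L[ℂ] K₂}
    (ha : IsCompactOperator a) (hb : IsCompactOperator b) : IsCompactOperator (hmap a b) := by
  have hcl := isClosed_setOfPred_isCompactOperator (σ₁₂ := RingHom.id ℂ)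
    (M₁ := HTensor H H₂) (M₂ := HTensor K K₂)
  suffices h : hmap a b ∈ closure {f : HTensor H H₂ →L[ℂ] HTensor K K₂ | IsCompactOperator f} from
    hcl.closure_subset h
  refine (SeminormedAddCommGroup.mem_closure_iff (E := HTensor H H₂ →L[ℂ] HTensor K K₂)).mpr
    fun ε hε => ?_
  obtain ⟨V, _, a', ha'⟩ := exists_finite_approx ha
    (ε := ε / (2 * (‖b‖ + 1))) (by positivity)
  obtain ⟨W, _, b', hb'⟩ := exists_finite_approx hb
    (ε := ε / (4 * (‖V.subtypeL ∘L a'‖ + 1))) (by positivity)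
  refine ⟨hmap (V.subtypeL ∘L a') (W.subtypeL ∘L b'),
    isCompactOperator_hmap_finite V W a' b', ?_⟩
  set p := V.subtypeL ∘L a'
  set q := W.subtypeL ∘L b'
  have hsplit : hmap a b - hmap p q = hmap (a - p) b + hmap p (b - q) := by
    have h1 : hmap a b = hmap (a - p) b + hmap p b := by
      rw [← hmap_add_left, sub_add_cancel]
    have h2 : hmap p b = hmap p (b - q) + hmap p q := by
      rw [← hmap_add_right, sub_add_cancel]
    rw [h1, h2]; abel
  rw [hsplit]
  have e1 : ‖hmap (a - p) b‖ ≤ ε / 2 := by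
    refine (norm_hmap_le _ _).trans ?_
    calc ‖a - p‖ * ‖b‖ ≤ ε / (2 * (‖b‖ + 1)) * (‖b‖ + 1) :=
          mul_le_mul ha' (by linarith) (norm_nonneg _) (by positivity)
      _ = ε / 2 := by field_simp
  have e2 : ‖hmap p (b - q)‖ ≤ ε / 4 := by
    refine (norm_hmap_le _ _).trans ?_
    calc ‖p‖ * ‖b - q‖ ≤ (‖p‖ + 1) * (ε / (4 * (‖p‖ + 1))) :=
          mul_le_mul (by linarith) hb' (norm_nonneg _) (by positivity)
      _ = ε / 4 := by field_simp
  have e3 : ‖hmap (a - p) b + hmap p (b - q)‖ ≤ ‖hmap (a - p) b‖ + ‖hmap p (b - q)‖ :=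
    norm_add_le _ _
  linarith

end Compact

/-! ### Amplifications -/

/-- The compact operators on `L`, with the operator norm. -/
abbrev KOp (L : Type*) [NormedAddCommGroup L] [InnerProductSpace ℂ L] :
    Submodule ℂ (L →L[ℂ] L) :=
  compactOperator (RingHom.id ℂ) L L

/-- The amplification of a linear space `E`: the algebraic tensor product of the compact operators
on `L` with `E`. -/
abbrev Amp (L : Type*) [NormedAddCommGroup L] [InnerProductSpace ℂ L]
    (E : Type*) [AddCommGroup E] [Module ℂ E] : Type _ :=
  KOp L ⊗[ℂ] E

section Amplification

variable {L : Type*} [NormedAddCommGroup L] [InnerProductSpace ℂ L]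
  {E F G : Type*} [AddCommGroup E] [Module ℂ E] [AddCommGroup F] [Module ℂ F]
  [AddCommGroup G] [Module ℂ G]

/-- Left multiplication of compact operators by a bounded operator. -/
def mulLeftK (b : L →L[ℂ] L) : KOp L →ₗ[ℂ] KOp L where
  toFun a := ⟨b * (a : L →L[ℂ] L), IsCompactOperator.clm_comp (f := ⇑(a : L →L[ℂ] L)) a.2 b⟩
  map_add' x y := Subtype.ext (mul_add b (x : L →L[ℂ] L) y)
  map_smul' c x := Subtype.ext (mul_smul_comm c b (x : L →L[ℂ] L))

/-- Right multiplication of compact operators by a bounded operator. -/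
def mulRightK (b : L →L[ℂ] L) : KOp L →ₗ[ℂ] KOp L where
  toFun a := ⟨(a : L →L[ℂ] L) * b, IsCompactOperator.comp_clm (f := ⇑(a : L →L[ℂ] L)) a.2 b⟩
  map_add' x y := Subtype.ext (add_mul (x : L →L[ℂ] L) y b)
  map_smul' c x := Subtype.ext (smul_mul_assoc c (x : L →L[ℂ] L) b)

/-- The left outer multiplication `b · u`, with `b · (a ⊗ x) = (b a) ⊗ x`. -/
def lact (b : L →L[ℂ] L) : Amp L E →ₗ[ℂ] Amp L E :=
  TensorProduct.map (mulLeftK b) LinearMap.id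

/-- The right outer multiplication `u · b`, with `(a ⊗ x) · b = (a b) ⊗ x`. -/
def ract (b : L →L[ℂ] L) : Amp L E →ₗ[ℂ] Amp L E :=
  TensorProduct.map (mulRightK b) LinearMap.id

/-- The amplification `a ⊗ x ↦ a ⊗ φ x` of a linear operator. -/
def amp (L : Type*) [NormedAddCommGroup L] [InnerProductSpace ℂ L] (φ : E →ₗ[ℂ] F) :
    Amp L E →ₗ[ℂ] Amp L F :=
  TensorProduct.map LinearMap.id φ

/-- Composition of compact operators, as a bilinear map. -/
def mulK : KOp L →ₗ[ℂ] KOp L →ₗ[ℂ] KOp L :=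
  LinearMap.mk₂ ℂ (fun a b => mulLeftK (a : L →L[ℂ] L) b)
    (fun a a' b => Subtype.ext (add_mul (a : L →L[ℂ] L) a' b))
    (fun c a b => Subtype.ext (smul_mul_assoc c (a : L →L[ℂ] L) b))
    (fun a b b' => map_add (mulLeftK (a : L →L[ℂ] L)) b b')
    (fun c a b => map_smul (mulLeftK (a : L →L[ℂ] L)) c b)

/-- The operation `a ⋄ b = ι* (a ⊗ b) ι` on bounded operators, where `ι` is a unitary isomorphism
of `L` onto its Hilbert tensor square. -/
def diamond (ι : L ≃ₗᵢ[ℂ] HTensor L L) (a b : L →L[ℂ] L) : L →L[ℂ] L :=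
  (ι.symm.toContinuousLinearEquiv : HTensor L L →L[ℂ] L) ∘L hmap a b ∘L
    (ι.toContinuousLinearEquiv : L →L[ℂ] HTensor L L)

theorem isCompactOperator_diamond (ι : L ≃ₗᵢ[ℂ] HTensor L L) {a b : L →L[ℂ] L}
    (ha : IsCompactOperator a) (hb : IsCompactOperator b) :
    IsCompactOperator (diamond ι a b) :=
  ((isCompactOperator_hmap ha hb).comp_clm
    (ι.toContinuousLinearEquiv : L →L[ℂ] HTensor L L)).clm_comp
      (ι.symm.toContinuousLinearEquiv : HTensor L L →L[ℂ] L)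

/-- The operation `a ⋄ b` on compact operators, as a bilinear map. -/
def diamondK (ι : L ≃ₗᵢ[ℂ] HTensor L L) : KOp L →ₗ[ℂ] KOp L →ₗ[ℂ] KOp L :=
  LinearMap.mk₂ ℂ
    (fun a b => ⟨diamond ι (a : L →L[ℂ] L) (b : L →L[ℂ] L), isCompactOperator_diamond ι a.2 b.2⟩)
    (fun a a' b => Subtype.ext (by ext x; simp [diamond, hmap_add_left]))
    (fun c a b => Subtype.ext (by ext x; simp [diamond, hmap_smul_left]))
    (fun a b b' => Subtype.ext (by ext x; simp [diamond, hmap_add_right]))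
    (fun c a b => Subtype.ext (by ext x; simp [diamond, hmap_smul_right]))

/-- The strong amplification of a bilinear operator `R`: `(a ⊗ x, b ⊗ y) ↦ (a b) ⊗ R x y`. -/
def strongAmp (R : E →ₗ[ℂ] F →ₗ[ℂ] G) : Amp L E →ₗ[ℂ] Amp L F →ₗ[ℂ] Amp L G :=
  TensorProduct.map₂ mulK R

/-- The weak amplification of a bilinear operator `R`: `(a ⊗ x, b ⊗ y) ↦ (a ⋄ b) ⊗ R x y`. -/
def weakAmp (ι : L ≃ₗᵢ[ℂ] HTensor L L) (R : E →ₗ[ℂ] F →ₗ[ℂ] G) :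
    Amp L E →ₗ[ℂ] Amp L F →ₗ[ℂ] Amp L G :=
  TensorProduct.map₂ (diamondK ι) R

/-- The Effros symbol `u ⊙ v`, with `(a ⊗ x) ⊙ (b ⊗ y) = (a b) ⊗ (x ⊗ y)`. -/
def effros (u : Amp L E) (v : Amp L F) : Amp L (E ⊗[ℂ] F) :=
  strongAmp (TensorProduct.mk ℂ E F) u v

/-- The extended diamond operation `u ⋄ v`, with `(a ⊗ x) ⋄ (b ⊗ y) = (a ⋄ b) ⊗ (x ⊗ y)`. -/
def diamondAmp (ι : L ≃ₗᵢ[ℂ] HTensor L L) (u : Amp L E) (v : Amp L F) : Amp L (E ⊗[ℂ] F) :=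
  weakAmp ι (TensorProduct.mk ℂ E F) u v

end Amplification

/-! ### Quantum norms -/

section Quantum

variable {L : Type*} [NormedAddCommGroup L] [InnerProductSpace ℂ L] [CompleteSpace L]
  {E F : Type*} [AddCommGroup E] [Module ℂ E] [AddCommGroup F] [Module ℂ F]

/-- `N` is a quantum norm on `E`: a norm on the amplification of `E` that satisfies both axioms of
Ruan. -/
structure IsQuantumNorm (N : Amp L E → ℝ) : Prop where
  add_le : ∀ u v, N (u + v) ≤ N u + N v
  smul_eq : ∀ (c : ℂ) u, N (c • u) = ‖c‖ * N u
  eq_zero_of_norm_eq_zero : ∀ u, N u = 0 → u = 0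
  lact_le : ∀ (b : L →L[ℂ] L) u, N (lact b u) ≤ ‖b‖ * N u
  ract_le : ∀ (b : L →L[ℂ] L) u, N (ract b u) ≤ ‖b‖ * N u
  add_eq_max : ∀ (P Q : L →L[ℂ] L) (u v : Amp L E), IsStarProjection P → IsStarProjection Q →
    P * Q = 0 → lact P u = u → ract P u = u → lact Q v = v → ract Q v = v →
    N (u + v) = max (N u) (N v)

/-- The linear isomorphism `φ` is a completely isometric isomorphism from the quantum space
`(E, N)` onto the quantum space `(F, M)`: `N` and `M` are quantum norms and the amplification of
`φ` carries `N` to `M`. -/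
structure IsCompleteIsometricIso (N : Amp L E → ℝ) (M : Amp L F → ℝ) (φ : E ≃ₗ[ℂ] F) :
    Prop where
  quantum_dom : IsQuantumNorm N
  quantum_cod : IsQuantumNorm M
  isometric : ∀ u, M (amp L (φ : E →ₗ[ℂ] F) u) = N u

/-- The norm that a quantum norm `N` on `F` induces on a linear space `E` embedded in `F` by `i`
(the quantum subspace structure). -/
def subNorm (i : E →ₗ[ℂ] F) (N : Amp L F → ℝ) (u : Amp L E) : ℝ :=
  N (amp L i u)

/-- The Haagerup norm on `E ⊗ F`: the infimum of `∑ ‖u k‖ ‖v k‖` over all representations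
`U = ∑ u k ⊙ v k`. -/
def haagerupNorm (N : Amp L E → ℝ) (M : Amp L F → ℝ) (U : Amp L (E ⊗[ℂ] F)) : ℝ :=
  sInf {r : ℝ | ∃ (n : ℕ) (u : Fin n → Amp L E) (v : Fin n → Amp L F),
    U = ∑ k, effros (u k) (v k) ∧ r = ∑ k, N (u k) * M (v k)}

/-- The four-named (operator-projective) norm on `E ⊗ F`: the infimum of
`∑ ‖a k‖ ‖u k‖ ‖v k‖ ‖b k‖` over all representations `U = ∑ a k · (u k ⋄ v k) · b k`
with `a k`, `b k` compact. -/
def fourNorm (ι : L ≃ₗᵢ[ℂ] HTensor L L) (N : Amp L E → ℝ) (M : Amp L F → ℝ)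
    (U : Amp L (E ⊗[ℂ] F)) : ℝ :=
  sInf {r : ℝ | ∃ (n : ℕ) (a : Fin n → KOp L) (u : Fin n → Amp L E) (v : Fin n → Amp L F)
      (b : Fin n → KOp L),
    U = ∑ k, lact (a k : L →L[ℂ] L) (ract (b k : L →L[ℂ] L) (diamondAmp ι (u k) (v k))) ∧
    r = ∑ k, ‖a k‖ * N (u k) * M (v k) * ‖b k‖}

end Quantum

/-! ### Concrete quantum norms, spatial tensor products, column and row Hilbertians -/

section Concrete

variable {E F : Type*} [AddCommGroup E] [Module ℂ E] [AddCommGroup F] [Module ℂ F]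
  {H₁ K₁ H₂ K₂ : Type*}
  [NormedAddCommGroup H₁] [InnerProductSpace ℂ H₁] [NormedAddCommGroup K₁] [InnerProductSpace ℂ K₁]
  [NormedAddCommGroup H₂] [InnerProductSpace ℂ H₂] [NormedAddCommGroup K₂] [InnerProductSpace ℂ K₂]

/-- The concrete norm on the amplification of `E` associated with an embedding
`I` of `E` into the bounded operators: the operator norm of the image of `u` under
`a ⊗ x ↦ a ⊗ I x`. -/
def concreteNorm (L : Type*) [NormedAddCommGroup L] [InnerProductSpace ℂ L]
    (I : E →ₗ[ℂ] (H₁ →L[ℂ] K₁)) (u : Amp L E) : ℝ :=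
  ‖TensorProduct.lift ((hmapₗ (H₁ := L) (K₁ := L) (H₂ := H₁) (K₂ := K₁)).compl₁₂
    (KOp L).subtype I) u‖

/-- The map `x ⊗ y ↦ I x ⊗ J y` that identifies `E ⊗ F` with the (non-completed) spatial tensor
product of the operator spaces `I(E)` and `J(F)`. -/
def spatialMap (I : E →ₗ[ℂ] (H₁ →L[ℂ] K₁)) (J : F →ₗ[ℂ] (H₂ →L[ℂ] K₂)) :
    E ⊗[ℂ] F →ₗ[ℂ] (HTensor H₁ H₂ →L[ℂ] HTensor K₁ K₂) :=
  TensorProduct.lift (hmapₗ.compl₁₂ I J)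

/-- The standard quantum norm of the spatial tensor product of two operator spaces. -/
def spatialNorm (L : Type*) [NormedAddCommGroup L] [InnerProductSpace ℂ L]
    (I : E →ₗ[ℂ] (H₁ →L[ℂ] K₁)) (J : F →ₗ[ℂ] (H₂ →L[ℂ] K₂)) : Amp L (E ⊗[ℂ] F) → ℝ :=
  concreteNorm L (spatialMap I J)

end Concrete

section Hilbertians

variable (H : Type*) [NormedAddCommGroup H] [InnerProductSpace ℂ H]

/-- The embedding of `H` into the operators from `ℂ` to `H`, with `x ↦ (1 ↦ x)`. -/
def colMap : H →ₗ[ℂ] (ℂ →L[ℂ] H) where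
  toFun x := ContinuousLinearMap.toSpanSingleton ℂ x
  map_add' x y := by ext; simp
  map_smul' c x := by ext; simp

/-- The embedding of `H` into the functionals on the complex-conjugate space of `H`, taking `x`
to the functional whose value at `y` is the inner product of `x` and `y` in `H` (linear in `x`
and conjugate linear in `y`). -/
def rowMap : H →ₗ[ℂ] (ConjSpace H →L[ℂ] ℂ) where
  toFun x := innerSL ℂ (toConj x)
  map_add' x y := map_add (innerSL ℂ) (toConj x) (toConj y)
  map_smul' c x := by
    ext y
    exact inner_smul_right (𝕜 := ℂ) (ofConj y) x c

theorem rowMap_apply (x y : H) : rowMap H x (toConj y) = inner ℂ y x := rfl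

/-- The quantum norm of the column Hilbertian. -/
def colNorm (L : Type*) [NormedAddCommGroup L] [InnerProductSpace ℂ L] : Amp L H → ℝ :=
  concreteNorm L (colMap H)

/-- The quantum norm of the row Hilbertian. -/
def rowNorm (L : Type*) [NormedAddCommGroup L] [InnerProductSpace ℂ L] : Amp L H → ℝ :=
  concreteNorm L (rowMap H)

/-- The quantum norm of the algebraic tensor square of `H` as a quantum subspace of the column
Hilbertian of the Hilbert tensor square. -/
def colSquareNorm (L : Type*) [NormedAddCommGroup L] [InnerProductSpace ℂ L] :
    Amp L (H ⊗[ℂ] H) → ℝ :=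
  subNorm toHTensor (colNorm (HTensor H H) L)

/-- The quantum norm of the algebraic tensor square of `H` as a quantum subspace of the row
Hilbertian of the Hilbert tensor square. -/
def rowSquareNorm (L : Type*) [NormedAddCommGroup L] [InnerProductSpace ℂ L] :
    Amp L (H ⊗[ℂ] H) → ℝ :=
  subNorm toHTensor (rowNorm (HTensor H H) L)

end Hilbertians

end

end QFA

open QFA

/-!
All four norms on the amplification of `H ⊗ H` are computed by one formula. Each `U` has an
expansion `U = ∑ a i j ⊗ (e i ⊗ e j)` along a finite orthonormal family `e` of `H`. In the column
case the spatial norm and the norm inherited from the column Hilbertian of the Hilbert tensor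
square have `‖∑ (a i j)* (a i j)‖` as their square, since the operators that represent the `e i ⊗
e j` are isometries with pairwise orthogonal ranges (`concreteNorm_sq_of_adjoint_comp`). In the
row case `a* a` becomes `a a*`. The two cases run in parallel, and `IsLengthSquare` collects what
they share.

The Haagerup and the operator-projective norm dominate this norm `M`, because the formula is
submultiplicative: `‖∑ (p i q j)* (p i q j)‖ ≤ ‖∑ (p i)* (p i)‖ ‖∑ (q j)* (q j)‖`, and the same
for `⋄` in place of the product.

For the opposite inequality, `ι` and an orthonormal family of `L` provide isometries `S i` of `L`
with orthogonal ranges. The formal factorization `a i j = (S i)* (∑ k, S k (a k j))` is optimal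
for the Haagerup norm, but its left factor is not compact. With a projection `P` of finite rank
inserted it represents `∑ P (a i j) ⊗ (e i ⊗ e j)` by a single term of cost at most `M U`
(`exists_column_mul_factorization`; `exists_column_diamond_factorization` is the analogue for
`⋄`). The remainder has small coefficients `a i j - P (a i j)`, and it costs little because each
compact operator is a combination of four fourth powers of compact operators of controlled norm
(`compact_induction`), hence factors through compact operators without a substantial loss.

Finally `M` is a concrete norm given by an injective map, so it is a quantum norm
(`isQuantumNorm_concreteNorm`), and with it so are the other three.
-/

namespace QFA

/-! ### Compact operators on a Hilbert space -/

section CompactOperators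

variable {L : Type*} [NormedAddCommGroup L] [InnerProductSpace ℂ L]

theorem isCompactOperator_of_forall_exists_norm_sub_le {a : L →L[ℂ] L}
    (h : ∀ ε > 0, ∃ b : L →L[ℂ] L, IsCompactOperator b ∧ ‖a - b‖ ≤ ε) [CompleteSpace L] :
    IsCompactOperator a := by
  have hcl := isClosed_setOfPred_isCompactOperator (σ₁₂ := RingHom.id ℂ) (M₁ := L) (M₂ := L)
  refine hcl.closure_subset (Metric.mem_closure_iff.mpr fun ε hε => ?_)
  obtain ⟨b, hb, hab⟩ := h (ε / 2) (half_pos hε)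
  exact ⟨b, hb, by rw [dist_eq_norm]; linarith⟩

variable [CompleteSpace L]

/-- Finitely many compact operators are simultaneously approximated by their left multiples with a
projection of finite rank. -/
theorem exists_isStarProjection_norm_sub_mul_le {κ : Type*} [Finite κ] (a : κ → L →L[ℂ] L)
    (ha : ∀ k, IsCompactOperator (a k)) {ε : ℝ} (hε : 0 < ε) :
    ∃ P : L →L[ℂ] L, IsCompactOperator P ∧ IsStarProjection P ∧ ∀ k, ‖a k - P * a k‖ ≤ ε := by
  choose V hV a' ha' using fun k => exists_finite_approx (ha k) hε
  have hfin : FiniteDimensional ℂ (⨆ k, V k : Submodule ℂ L) :=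
    Submodule.finiteDimensional_iSup V
  set W : Submodule ℂ L := ⨆ k, V k
  have hP : IsStarProjection W.starProjection := isStarProjection_starProjection
  refine ⟨W.starProjection, ?_, hP, fun k => ?_⟩
  · have : ProperSpace W := FiniteDimensional.proper ℂ _
    have hid : IsCompactOperator (id : W → W) :=
      ⟨Metric.closedBall 0 1, isCompact_closedBall 0 1, Metric.closedBall_mem_nhds 0 one_pos⟩
    exact (hid.clm_comp W.subtypeL).comp_clm W.orthogonalProjectionOnto
  · have hv : W.starProjection * ((V k).subtypeL ∘L a' k) = (V k).subtypeL ∘L a' k := by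
      ext x
      exact Submodule.starProjection_eq_self_iff.mpr
        (le_iSup V k (a' k x).2 : ((a' k x : L)) ∈ W)
    have key : a k - W.starProjection * a k
        = (1 - W.starProjection) * (a k - (V k).subtypeL ∘L a' k) := by
      rw [sub_mul, one_mul, mul_sub, hv]; abel
    rw [key]
    calc _ ≤ ‖1 - W.starProjection‖ * ‖a k - (V k).subtypeL ∘L a' k‖ := norm_mul_le _ _
      _ ≤ 1 * ε := mul_le_mul hP.one_sub.norm_le (ha' k) (norm_nonneg _) zero_le_one
      _ = ε := one_mul ε

/-- Schauder's theorem for operators on a Hilbert space. -/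
theorem isCompactOperator_star {a : L →L[ℂ] L} (ha : IsCompactOperator a) :
    IsCompactOperator (star a : L →L[ℂ] L) := by
  refine isCompactOperator_of_forall_exists_norm_sub_le fun ε hε => ?_
  obtain ⟨P, hPc, hP, h⟩ :=
    exists_isStarProjection_norm_sub_mul_le (fun _ : Unit => a) (fun _ => ha) hε
  refine ⟨star a * P, hPc.clm_comp (star a), ?_⟩
  have : star a - star a * P = star (a - P * a) := by
    rw [star_sub, star_mul, hP.isSelfAdjoint.star_eq]
  rw [this, norm_star]
  exact h ()

/-- A self-adjoint operator with compact square is compact: `‖s - P s‖²` is at most the norm of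
`s² - P s²` for each projection `P`. -/
theorem isCompactOperator_of_mul_self {s : L →L[ℂ] L} (hs : IsSelfAdjoint s)
    (h : IsCompactOperator (s * s)) : IsCompactOperator s := by
  refine isCompactOperator_of_forall_exists_norm_sub_le fun ε hε => ?_
  obtain ⟨P, hPc, hP, h⟩ :=
    exists_isStarProjection_norm_sub_mul_le (fun _ : Unit => s * s) (fun _ => h) (pow_pos hε 2)
  refine ⟨P * s, hPc.comp_clm s, ?_⟩
  have h1 : ‖s - P * s‖ ^ 2 ≤ ε ^ 2 := by
    have key : (s - P * s) * star (s - P * s) = (s * s - P * (s * s)) * (1 - P) := by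
      rw [star_sub, star_mul, hs.star_eq, hP.isSelfAdjoint.star_eq]
      noncomm_ring
    rw [sq, ← CStarRing.norm_self_mul_star, key]
    calc _ ≤ ‖s * s - P * (s * s)‖ * ‖1 - P‖ := norm_mul_le _ _
      _ ≤ ε ^ 2 * 1 := mul_le_mul (h ()) hP.one_sub.norm_le (norm_nonneg _) (by positivity)
      _ = ε ^ 2 := mul_one _
  exact (pow_le_pow_iff_left₀ (norm_nonneg _) hε.le two_ne_zero).mp h1

theorem exists_pow_four_eq_of_nonneg {a : L →L[ℂ] L} (ha : IsCompactOperator a) (h0 : 0 ≤ a) :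
    ∃ t : KOp L, (t : L →L[ℂ] L) ^ 4 = a ∧ ‖t‖ ^ 4 = ‖a‖ := by
  have hs0 : 0 ≤ CFC.sqrt a := CFC.sqrt_nonneg a
  have ht0 : 0 ≤ CFC.sqrt (CFC.sqrt a) := CFC.sqrt_nonneg _
  have hs := CFC.sqrt_mul_sqrt_self a h0
  have ht := CFC.sqrt_mul_sqrt_self (CFC.sqrt a) hs0
  have hsc : IsCompactOperator (CFC.sqrt a : L →L[ℂ] L) :=
    isCompactOperator_of_mul_self hs0.isSelfAdjoint (by rwa [hs])
  have htc : IsCompactOperator (CFC.sqrt (CFC.sqrt a) : L →L[ℂ] L) :=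
    isCompactOperator_of_mul_self ht0.isSelfAdjoint (by rwa [ht])
  refine ⟨⟨CFC.sqrt (CFC.sqrt a), htc⟩, ?_, ?_⟩
  · change CFC.sqrt (CFC.sqrt a) ^ 4 = a
    rw [show 4 = 2 * 2 from rfl, pow_mul, pow_two (CFC.sqrt (CFC.sqrt a)), ht, pow_two, hs]
  · change ‖CFC.sqrt (CFC.sqrt a)‖ ^ 4 = ‖a‖
    have e : ∀ x : L →L[ℂ] L, IsSelfAdjoint x → ‖x * x‖ = ‖x‖ ^ 2 := fun x hx => by
      nth_rw 1 [← hx.star_eq]; rw [CStarRing.norm_star_mul_self, sq]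
    rw [show 4 = 2 * 2 from rfl, pow_mul, ← e _ ht0.isSelfAdjoint, ht, ← e _ hs0.isSelfAdjoint, hs]

/-- Each compact operator is a combination of at most four fourth powers of compact operators, with
control of the norms. The statement is an induction principle for predicates `Φ a r`, to be read
as `a` admits a representation of cost at most `r`. -/
theorem compact_induction {Φ : KOp L → ℝ → Prop}
    (hadd : ∀ a b r s, Φ a r → Φ b s → Φ (a + b) (r + s))
    (hmono : ∀ a r s, Φ a r → r ≤ s → Φ a s)
    (hpow : ∀ (z : ℂ) (t a : KOp L), ‖z‖ = 1 → (a : L →L[ℂ] L) = z • (t : L →L[ℂ] L) ^ 4 →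
      Φ a (‖t‖ ^ 4)) (a : KOp L) : Φ a (4 * ‖a‖) := by
  have pos : ∀ (z : ℂ) (a : L →L[ℂ] L) (b : KOp L), ‖z‖ = 1 → IsCompactOperator a → 0 ≤ a →
      (b : L →L[ℂ] L) = z • a → Φ b ‖a‖ := by
    intro z a b hz ha h0 hb
    obtain ⟨t, ht, hn⟩ := exists_pow_four_eq_of_nonneg ha h0
    rw [← hn]
    exact hpow z t b hz (by rw [hb, ht])
  have sa : ∀ (z : ℂ) (a : L →L[ℂ] L) (b : KOp L), ‖z‖ = 1 → IsCompactOperator a →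
      IsSelfAdjoint a → (b : L →L[ℂ] L) = z • a → Φ b (‖a‖ + ‖a‖) := by
    intro z a b hz ha hsa hb
    have hp0 : 0 ≤ a⁺ := CFC.posPart_nonneg a
    have hn0 : 0 ≤ a⁻ := CFC.negPart_nonneg a
    have hsub := CFC.posPart_sub_negPart a hsa
    have hpc : IsCompactOperator (a⁺ : L →L[ℂ] L) := by
      refine isCompactOperator_of_mul_self hp0.isSelfAdjoint ?_
      -- The square of the positive part is a multiple of `a`, hence compact.
      have : a⁺ * a⁺ = a * a⁺ := by
        conv_rhs => enter [1]; rw [← hsub]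
        rw [sub_mul, CFC.negPart_mul_posPart, sub_zero]
      rw [this]
      exact ha.comp_clm _
    have hnc : IsCompactOperator (a⁻ : L →L[ℂ] L) := by
      have : a⁻ = a⁺ - a := eq_sub_of_add_eq (sub_eq_iff_eq_add'.mp hsub).symm
      rw [this]
      exact hpc.sub ha
    have := hadd _ _ _ _ (pos z a⁺ ⟨z • a⁺, hpc.smul z⟩ hz hpc hp0 rfl)
      (pos (-z) a⁻ ⟨(-z) • a⁻, hnc.smul (-z)⟩ (by rwa [norm_neg]) hnc hn0 rfl)
    have hbe : b = (⟨z • a⁺, hpc.smul z⟩ : KOp L) + ⟨(-z) • a⁻, hnc.smul (-z)⟩ := by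
      refine Subtype.ext ?_
      change (b : L →L[ℂ] L) = z • a⁺ + (-z) • a⁻
      rw [hb, neg_smul, ← sub_eq_add_neg, ← smul_sub, hsub]
    rw [hbe]
    exact hmono _ _ _ this
      (add_le_add (CStarAlgebra.norm_posPart_le a) (CStarAlgebra.norm_negPart_le a))
  -- The general case follows by splitting `a` into its real part `y` and imaginary part `w`.
  set x : L →L[ℂ] L := a.1
  have hx : IsCompactOperator x := a.2
  have hxs := isCompactOperator_star hx
  set y : L →L[ℂ] L := (1 / 2 : ℂ) • (x + star x) with hy
  set w : L →L[ℂ] L := (Complex.I / 2 : ℂ) • (star x - x) with hw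
  have hyc : IsCompactOperator y := (hx.add hxs).smul (1 / 2 : ℂ)
  have hwc : IsCompactOperator w := (hxs.sub hx).smul (Complex.I / 2 : ℂ)
  have hysa : IsSelfAdjoint y := by
    simp [IsSelfAdjoint, hy, star_smul, add_comm]
  have hwsa : IsSelfAdjoint w := by
    simp [IsSelfAdjoint, hw, star_smul, neg_div, ← smul_neg]
  have hyn : ‖y‖ ≤ ‖a‖ := by
    have h1 := norm_add_le x (star x)
    rw [norm_star] at h1
    rw [hy, norm_smul]
    have : ‖x‖ = ‖a‖ := rfl
    norm_num
    linarith
  have hwn : ‖w‖ ≤ ‖a‖ := by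
    have h1 := norm_sub_le (star x) x
    rw [norm_star] at h1
    rw [hw, norm_smul]
    have : ‖x‖ = ‖a‖ := rfl
    norm_num
    linarith
  have hsum : a = (⟨(1 : ℂ) • y, hyc.smul (1 : ℂ)⟩ : KOp L)
      + ⟨Complex.I • w, hwc.smul Complex.I⟩ := by
    refine Subtype.ext ?_
    change x = (1 : ℂ) • y + Complex.I • w
    rw [hy, hw, one_smul, smul_smul, ← mul_div_assoc, Complex.I_mul_I]
    module
  have := hadd _ _ _ _ (sa 1 y ⟨(1 : ℂ) • y, hyc.smul (1 : ℂ)⟩ norm_one hyc hysa rfl)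
    (sa Complex.I w ⟨Complex.I • w, hwc.smul Complex.I⟩ Complex.norm_I hwc hwsa rfl)
  rw [← hsum] at this
  exact hmono _ _ _ this (by linarith)

end CompactOperators

/-! ### Adjoints of Hilbert tensor products of operators -/

section Adjoint

variable {H₁ K₁ H₂ K₂ : Type*}
  [NormedAddCommGroup H₁] [InnerProductSpace ℂ H₁] [NormedAddCommGroup K₁] [InnerProductSpace ℂ K₁]
  [NormedAddCommGroup H₂] [InnerProductSpace ℂ H₂] [NormedAddCommGroup K₂] [InnerProductSpace ℂ K₂]

theorem hmap_id : hmap (.id ℂ H₁) (.id ℂ H₂) = .id ℂ (HTensor H₁ H₂) :=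
  htensor_ext fun z => by
    rw [hmap_toHTensor, ContinuousLinearMap.coe_id, ContinuousLinearMap.coe_id,
      TensorProduct.map_id]
    rfl

theorem hmap_zero_left (b : H₂ →L[ℂ] K₂) : hmap (0 : H₁ →L[ℂ] K₁) b = 0 :=
  LinearMap.map_zero₂ hmapₗ b

theorem hmap_zero_right (a : H₁ →L[ℂ] K₁) : hmap a (0 : H₂ →L[ℂ] K₂) = 0 :=
  map_zero (hmapₗ a)

theorem hmap_sum_left {κ : Type*} (s : Finset κ) (a : κ → H₁ →L[ℂ] K₁) (b : H₂ →L[ℂ] K₂) :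
    hmap (∑ k ∈ s, a k) b = ∑ k ∈ s, hmap (a k) b :=
  LinearMap.map_sum₂ hmapₗ s a b

theorem hmap_tmul (a : H₁ →L[ℂ] K₁) (b : H₂ →L[ℂ] K₂) (x : H₁) (y : H₂) :
    hmap a b (toHTensor (x ⊗ₜ y)) = toHTensor (a x ⊗ₜ b y) := by
  rw [hmap_toHTensor, TensorProduct.map_tmul]; rfl

theorem htensor_ext_tmul {G : Type*} [NormedAddCommGroup G] [NormedSpace ℂ G]
    {f g : HTensor H₁ H₂ →L[ℂ] G}
    (h : ∀ x y, f (toHTensor (x ⊗ₜ y)) = g (toHTensor (x ⊗ₜ y))) : f = g :=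
  htensor_ext fun z => by
    induction z with
    | zero => simp
    | tmul x y => exact h x y
    | add z w hz hw => simp only [map_add, hz, hw]

theorem htensor_ext_inner {u v : HTensor H₁ H₂}
    (h : ∀ x y, inner ℂ u (toHTensor (x ⊗ₜ y)) = inner ℂ v (toHTensor (x ⊗ₜ y))) : u = v := by
  have := htensor_ext_tmul (f := innerSL ℂ u) (g := innerSL ℂ v) h
  exact ext_inner_right ℂ fun w => congrArg (fun f : HTensor H₁ H₂ →L[ℂ] ℂ => f w) this

theorem inner_toHTensor_tmul (x x' : H₁) (y y' : H₂) :
    inner ℂ (toHTensor (x ⊗ₜ[ℂ] y)) (toHTensor (x' ⊗ₜ[ℂ] y')) = inner ℂ x x' * inner ℂ y y' := by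
  rw [inner_toHTensor, TensorProduct.inner_tmul]

theorem norm_toHTensor_tmul (x : H₁) (y : H₂) : ‖toHTensor (x ⊗ₜ[ℂ] y)‖ = ‖x‖ * ‖y‖ := by
  rw [norm_toHTensor, TensorProduct.norm_tmul]

variable [CompleteSpace H₁] [CompleteSpace H₂] [CompleteSpace K₁] [CompleteSpace K₂]

theorem adjoint_hmap (a : H₁ →L[ℂ] K₁) (b : H₂ →L[ℂ] K₂) :
    (hmap a b).adjoint = hmap a.adjoint b.adjoint :=
  htensor_ext_tmul fun x y => htensor_ext_inner fun x' y' => by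
    rw [ContinuousLinearMap.adjoint_inner_left, hmap_tmul, hmap_tmul, inner_toHTensor_tmul,
      inner_toHTensor_tmul, ContinuousLinearMap.adjoint_inner_left,
      ContinuousLinearMap.adjoint_inner_left]

end Adjoint

/-! ### The operation `⋄` and isometries with orthogonal ranges -/

section Diamond

variable {L : Type*} [NormedAddCommGroup L] [InnerProductSpace ℂ L]
  (ι : L ≃ₗᵢ[ℂ] HTensor L L)

theorem diamond_apply (a b : L →L[ℂ] L) (x : L) : diamond ι a b x = ι.symm (hmap a b (ι x)) := rfl

theorem diamond_mul_diamond (a b a' b' : L →L[ℂ] L) :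
    diamond ι a b * diamond ι a' b' = diamond ι (a * a') (b * b') := by
  ext x
  rw [mul_apply_eq_comp, diamond_apply, diamond_apply, diamond_apply,
    ι.apply_symm_apply]
  exact congrArg (fun f : HTensor L L →L[ℂ] HTensor L L => ι.symm (f (ι x)))
    (hmap_comp a b a' b').symm

theorem norm_diamond_le (a b : L →L[ℂ] L) : ‖diamond ι a b‖ ≤ ‖a‖ * ‖b‖ := by
  refine ContinuousLinearMap.opNorm_le_bound _ (by positivity) fun x => ?_
  rw [diamond_apply, LinearIsometryEquiv.norm_map]
  calc _ ≤ ‖hmap a b‖ * ‖ι x‖ := (hmap a b).le_opNorm _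
    _ ≤ ‖a‖ * ‖b‖ * ‖x‖ := by
      rw [ι.norm_map]; exact mul_le_mul_of_nonneg_right (norm_hmap_le a b) (norm_nonneg x)

theorem diamond_sum_sum {κ κ' : Type*} (s : Finset κ) (t : Finset κ') (a : κ → L →L[ℂ] L)
    (b : κ' → L →L[ℂ] L) :
    diamond ι (∑ i ∈ s, a i) (∑ j ∈ t, b j) = ∑ i ∈ s, ∑ j ∈ t, diamond ι (a i) (b j) := by
  ext x
  have h : hmap (∑ i ∈ s, a i) (∑ j ∈ t, b j) = ∑ i ∈ s, ∑ j ∈ t, hmap (a i) (b j) := by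
    rw [hmap_sum_left]
    exact Finset.sum_congr rfl fun i _ => map_sum (hmapₗ (a i)) b t
  simp only [diamond_apply, h, FunLike.coe_sum, Finset.sum_apply, map_sum]

/-- The bounded operator `x ↦ ι⁻¹ (x ⊗ f)` on `L`. When `f` runs through an orthonormal family,
these are isometries with pairwise orthogonal ranges. -/
noncomputable def slot (f : L) : L →L[ℂ] L :=
  LinearMap.mkContinuous
    ((ι.symm.toLinearEquiv : HTensor L L →ₗ[ℂ] L) ∘ₗ toHTensor ∘ₗ (TensorProduct.mk ℂ L L).flip f)
    ‖f‖ fun x => by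
      change ‖ι.symm (toHTensor (x ⊗ₜ f))‖ ≤ _
      rw [LinearIsometryEquiv.norm_map, norm_toHTensor_tmul, mul_comm]

theorem slot_apply (f x : L) : slot ι f x = ι.symm (toHTensor (x ⊗ₜ f)) := rfl

theorem norm_slot_le (f : L) : ‖slot ι f‖ ≤ ‖f‖ :=
  LinearMap.mkContinuous_norm_le _ (norm_nonneg f) _

variable [CompleteSpace L]

theorem star_diamond (a b : L →L[ℂ] L) : star (diamond ι a b) = diamond ι (star a) (star b) := by
  refine ContinuousLinearMap.ext fun x => ext_inner_right ℂ fun y => ?_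
  rw [ContinuousLinearMap.star_eq_adjoint, ContinuousLinearMap.adjoint_inner_left, diamond_apply,
    diamond_apply, ← ι.inner_map_map, ι.apply_symm_apply, ← ι.inner_map_map (ι.symm _),
    ι.apply_symm_apply, ContinuousLinearMap.star_eq_adjoint, ContinuousLinearMap.star_eq_adjoint,
    ← adjoint_hmap, ContinuousLinearMap.adjoint_inner_left]

theorem star_slot_apply (g x y : L) :
    star (slot ι g) (ι.symm (toHTensor (x ⊗ₜ y))) = inner ℂ g y • x := by
  refine ext_inner_right ℂ fun w => ?_
  rw [ContinuousLinearMap.star_eq_adjoint, ContinuousLinearMap.adjoint_inner_left, slot_apply,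
    LinearIsometryEquiv.inner_map_map, inner_toHTensor_tmul, inner_smul_left, inner_conj_symm,
    mul_comm]

theorem star_slot_mul_slot (f g : L) : star (slot ι f) * slot ι g = inner ℂ f g • 1 := by
  ext x
  rw [mul_apply_eq_comp, slot_apply, star_slot_apply]
  rfl

/-- If the second operand has rank one, `⋄` becomes a product with two of the isometries. -/
theorem diamond_rankOne (p : L →L[ℂ] L) (f g : L) :
    diamond ι p (InnerProductSpace.rankOne ℂ f g) = slot ι f * p * star (slot ι g) := by
  have h : hmap p (InnerProductSpace.rankOne ℂ f g)
      = (ι.toContinuousLinearEquiv : L →L[ℂ] HTensor L L) ∘L (slot ι f * p * star (slot ι g)) ∘L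
        (ι.symm.toContinuousLinearEquiv : HTensor L L →L[ℂ] L) :=
    htensor_ext_tmul fun x y => by
      change _ = ι (slot ι f (p (star (slot ι g) (ι.symm _))))
      rw [star_slot_apply, map_smul, map_smul, map_smul, slot_apply, ι.apply_symm_apply, hmap_tmul,
        InnerProductSpace.rankOne_apply, TensorProduct.tmul_smul, map_smul]
  ext x
  rw [diamond_apply, h]
  change ι.symm (ι ((slot ι f * p * star (slot ι g)) (ι.symm (ι x)))) = _
  rw [ι.symm_apply_apply, ι.symm_apply_apply]

end Diamond

/-! ### Columns in a C*-algebra -/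

section CStar

variable {A : Type*} [CStarAlgebra A] {κ κ' : Type*}

/-- The column of the products `p i * q j` is at most as long as the product of the lengths of the
columns of the `p i` and the `q j`: with `X = ∑ (p i)* (p i)`, its square is
`∑ (q j)* X (q j) ≤ ‖X‖ ∑ (q j)* (q j)`. -/
theorem norm_sum_star_mul_mul_le [PartialOrder A] [StarOrderedRing A] (s : Finset κ)
    (t : Finset κ') (p : κ → A) (q : κ' → A) :
    ‖∑ i ∈ s, ∑ j ∈ t, star (p i * q j) * (p i * q j)‖
      ≤ ‖∑ i ∈ s, star (p i) * p i‖ * ‖∑ j ∈ t, star (q j) * q j‖ := by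
  set X := ∑ i ∈ s, star (p i) * p i
  have hX : 0 ≤ X := Finset.sum_nonneg fun i _ => star_mul_self_nonneg (p i)
  have h1 : ∑ i ∈ s, ∑ j ∈ t, star (p i * q j) * (p i * q j) = ∑ j ∈ t, star (q j) * X * q j := by
    rw [Finset.sum_comm]
    refine Finset.sum_congr rfl fun j _ => ?_
    rw [Finset.mul_sum, Finset.sum_mul]
    exact Finset.sum_congr rfl fun i _ => by rw [star_mul]; simp only [mul_assoc]
  rw [h1]
  calc _ ≤ ‖∑ j ∈ t, ‖X‖ • (star (q j) * q j)‖ :=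
        CStarAlgebra.norm_le_norm_of_nonneg_of_le
          (Finset.sum_nonneg fun j _ => star_left_conjugate_nonneg hX (q j))
          (Finset.sum_le_sum fun j _ =>
            CStarAlgebra.star_left_conjugate_le_norm_smul (hb := hX.isSelfAdjoint))
    _ = ‖X‖ * ‖∑ j ∈ t, star (q j) * q j‖ := by
        rw [← Finset.smul_sum, norm_smul, norm_norm]

/-- The sum of the range projections of partial isometries `w i` with pairwise orthogonal ranges
and a common initial projection `e` is a contraction. -/
theorem norm_sum_mul_star_le_one [DecidableEq κ] (s : Finset κ) (w : κ → A) (e : A)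
    (hw : ∀ i j, star (w i) * w j = if i = j then e else 0) (he : ∀ i, w i * e = w i) :
    ‖∑ i ∈ s, w i * star (w i)‖ ≤ 1 := by
  refine IsStarProjection.norm_le _ ⟨?_, ?_⟩
  · change (∑ i ∈ s, w i * star (w i)) * (∑ i ∈ s, w i * star (w i)) = _
    rw [Finset.sum_mul_sum]
    refine Finset.sum_congr rfl fun i hi => ?_
    have : ∀ j, w i * star (w i) * (w j * star (w j)) = if i = j then w i * star (w i) else 0 := by
      intro j
      rw [mul_assoc, ← mul_assoc (star (w i)), hw]
      split_ifs with h
      · rw [← mul_assoc, he, h]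
      · simp
    simp only [this, Finset.sum_ite_eq, hi, if_true]
  · simp [IsSelfAdjoint, star_sum]

end CStar

/-! ### Factorization of columns and rows of compact operators -/

section Factorization

variable {L : Type*} [NormedAddCommGroup L] [InnerProductSpace ℂ L]

theorem exists_orthonormal_fin (hL : ¬ FiniteDimensional ℂ L) (n : ℕ) :
    ∃ f : Fin n → L, Orthonormal ℂ f := by
  have hr : (n : Cardinal) ≤ Module.rank ℂ L := by
    refine le_trans (Cardinal.natCast_lt_aleph0 (n := n)).le (not_lt.mp fun h => hL ?_)
    exact Module.rank_lt_aleph0_iff.mp h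
  obtain ⟨f, hf⟩ := exists_linearIndependent_of_le_rank hr
  exact ⟨_, InnerProductSpace.gramSchmidtNormed_orthonormal hf⟩

theorem exists_norm_eq_one (hL : ¬ FiniteDimensional ℂ L) : ∃ g : L, ‖g‖ = 1 := by
  obtain ⟨f, hf⟩ := exists_orthonormal_fin hL 1
  exact ⟨f 0, hf.1 0⟩

theorem isCompactOperator_rankOne (f g : L) :
    IsCompactOperator (InnerProductSpace.rankOne ℂ f g) := by
  have hid : IsCompactOperator (id : ℂ → ℂ) :=
    ⟨Metric.closedBall 0 1, isCompact_closedBall 0 1, Metric.closedBall_mem_nhds 0 one_pos⟩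
  rw [InnerProductSpace.rankOne_def']
  exact (hid.clm_comp (ContinuousLinearMap.toSpanSingleton ℂ f)).comp_clm (innerSL ℂ g)

theorem isCompactOperator_sum {κ : Type*} (s : Finset κ) (a : κ → L →L[ℂ] L)
    (ha : ∀ k, IsCompactOperator (a k)) : IsCompactOperator (∑ k ∈ s, a k : L →L[ℂ] L) :=
  Submodule.sum_mem (KOp L) fun k _ => ha k

theorem coe_mulK (a b : KOp L) : (mulK a b : L →L[ℂ] L) = a * b := rfl

theorem coe_diamondK (ι : L ≃ₗᵢ[ℂ] HTensor L L) (a b : KOp L) :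
    (diamondK ι a b : L →L[ℂ] L) = diamond ι a b := rfl

variable [CompleteSpace L]

theorem star_slot_mul_slot_of_orthonormal (ι : L ≃ₗᵢ[ℂ] HTensor L L) {κ : Type*}
    [DecidableEq κ] {f : κ → L} (hf : Orthonormal ℂ f) (i j : κ) :
    star (slot ι (f i)) * slot ι (f j) = if i = j then 1 else 0 := by
  rw [star_slot_mul_slot, orthonormal_iff_ite.mp hf]
  split_ifs <;> simp

/-- With isometries `S i` with orthogonal ranges and a projection `P` of finite rank, take
`p i = P (S i)*` and `q j = ∑ i, S i (a i j)`. Then `p i * q j = P (a i j)`, the column of the `q j`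
is as long as that of the `a i j`, and the column of the `p i` is a contraction. -/
theorem exists_column_mul_factorization (ι : L ≃ₗᵢ[ℂ] HTensor L L)
    (hL : ¬ FiniteDimensional ℂ L) {n : ℕ}
    (a : Fin n → Fin n → KOp L) {ε : ℝ} (hε : 0 < ε) :
    ∃ p q : Fin n → KOp L, (∀ i j, ‖a i j - mulK (p i) (q j)‖ ≤ ε) ∧
      ‖∑ i, star (p i : L →L[ℂ] L) * p i‖ ≤ 1 ∧
      ‖∑ j, star (q j : L →L[ℂ] L) * q j‖ ≤ ‖∑ i, ∑ j, star (a i j : L →L[ℂ] L) * a i j‖ := by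
  obtain ⟨f, hf⟩ := exists_orthonormal_fin hL n
  obtain ⟨P, hPc, hP, h⟩ := exists_isStarProjection_norm_sub_mul_le
    (fun k : Fin n × Fin n => (a k.1 k.2 : L →L[ℂ] L)) (fun k => (a k.1 k.2).2) hε
  set S : Fin n → L →L[ℂ] L := fun i => slot ι (f i)
  have hS : ∀ i j, star (S i) * S j = if i = j then 1 else 0 :=
    star_slot_mul_slot_of_orthonormal ι hf
  have hPP : P * P = P := hP.isIdempotentElem
  have hPs : star P = P := hP.isSelfAdjoint
  refine ⟨fun i => ⟨P * star (S i), hPc.comp_clm (star (S i))⟩,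
    fun j => ⟨∑ i, S i * a i j, isCompactOperator_sum _ _ fun i => (a i j).2.clm_comp (S i)⟩,
    fun i j => ?_, ?_, ?_⟩
  · have : P * star (S i) * ∑ k, S k * (a k j : L →L[ℂ] L) = P * a i j := by
      rw [mul_assoc, Finset.mul_sum]
      simp only [← mul_assoc (star (S i)), hS, ite_mul, one_mul, zero_mul, Finset.sum_ite_eq,
        Finset.mem_univ, if_true]
    change ‖(a i j : L →L[ℂ] L) - P * star (S i) * ∑ k, S k * (a k j : L →L[ℂ] L)‖ ≤ ε
    rw [this]
    exact h (i, j)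
  · have := norm_sum_mul_star_le_one Finset.univ (fun i => S i * P) P (fun i j => by
      rw [star_mul, hPs, mul_assoc, ← mul_assoc (star (S i)), hS]
      split_ifs <;> simp [hPP]) (fun i => by rw [mul_assoc, hPP])
    simpa only [star_mul, star_star, hPs] using this
  · refine (congrArg norm ?_).le
    rw [Finset.sum_comm (f := fun i j => star (a i j : L →L[ℂ] L) * a i j)]
    refine Finset.sum_congr rfl fun j _ => ?_
    change star (∑ i, S i * (a i j : L →L[ℂ] L)) * ∑ i, S i * (a i j : L →L[ℂ] L) = _
    rw [star_sum, Finset.sum_mul_sum]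
    refine Finset.sum_congr rfl fun i _ => ?_
    simp only [star_mul, mul_assoc, ← mul_assoc (star (S i)), hS, ite_mul, one_mul, zero_mul,
      mul_ite, mul_zero, Finset.sum_ite_eq, Finset.mem_univ, if_true]

/-- With isometries `S i` with orthogonal ranges, coming from an orthonormal family `f`, a unit
vector `g` with isometry `T`, and a projection `P` of finite rank, take `p i = P (S i)*` and let
`q j` be the operator of rank one taking `f j` to `g`. Then `p i ⋄ q j = T P (S i)* (S j)*`, so
that `x = P T*` and `y = ∑ i j, S j S i (a i j)` satisfy `x (p i ⋄ q j) y = P (a i j)`. -/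
theorem exists_column_diamond_factorization (ι : L ≃ₗᵢ[ℂ] HTensor L L)
    (hL : ¬ FiniteDimensional ℂ L) {n : ℕ}
    (a : Fin n → Fin n → KOp L) {ε : ℝ} (hε : 0 < ε) :
    ∃ (x y : KOp L) (p q : Fin n → KOp L),
      (∀ i j, ‖(a i j : L →L[ℂ] L) - x * diamond ι (p i) (q j) * y‖ ≤ ε) ∧ ‖x‖ ≤ 1 ∧
      ‖∑ i, star (p i : L →L[ℂ] L) * p i‖ ≤ 1 ∧ ‖∑ i, star (q i : L →L[ℂ] L) * q i‖ ≤ 1 ∧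
      ‖y‖ ^ 2 ≤ ‖∑ i, ∑ j, star (a i j : L →L[ℂ] L) * a i j‖ := by
  obtain ⟨f, hf⟩ := exists_orthonormal_fin hL n
  obtain ⟨g, hg⟩ := exists_norm_eq_one hL
  obtain ⟨P, hPc, hP, h⟩ := exists_isStarProjection_norm_sub_mul_le
    (fun k : Fin n × Fin n => (a k.1 k.2 : L →L[ℂ] L)) (fun k => (a k.1 k.2).2) hε
  set S : Fin n → L →L[ℂ] L := fun i => slot ι (f i) with hSdef
  set T : L →L[ℂ] L := slot ι g with hTdef
  have hS : ∀ i j, star (S i) * S j = if i = j then 1 else 0 :=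
    star_slot_mul_slot_of_orthonormal ι hf
  have hT : star T * T = 1 := by
    rw [star_slot_mul_slot, inner_self_eq_norm_sq_to_K, hg]; simp
  have hPP : P * P = P := hP.isIdempotentElem
  have hPs : star P = P := hP.isSelfAdjoint
  have hyc : IsCompactOperator (∑ i, ∑ j, S j * (S i * a i j) : L →L[ℂ] L) :=
    isCompactOperator_sum _ _ fun i => isCompactOperator_sum _ _ fun j =>
      ((a i j).2.clm_comp (S i)).clm_comp (S j)
  have hSy : ∀ j, star (S j) * ∑ k, ∑ l, S l * (S k * (a k l : L →L[ℂ] L))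
      = ∑ k, S k * a k j := fun j => by
    simp only [Finset.mul_sum, ← mul_assoc (star (S j)), hS, ite_mul, one_mul, zero_mul,
      Finset.sum_ite_eq, Finset.mem_univ, if_true]
  have hSSy : ∀ i j, star (S i) * (star (S j) * ∑ k, ∑ l, S l * (S k * (a k l : L →L[ℂ] L)))
      = a i j := fun i j => by
    rw [hSy]
    simp only [Finset.mul_sum, ← mul_assoc (star (S i)), hS, ite_mul, one_mul, zero_mul,
      Finset.sum_ite_eq, Finset.mem_univ, if_true]
  refine ⟨⟨P * star T, hPc.comp_clm (star T)⟩, ⟨_, hyc⟩,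
    fun i => ⟨P * star (S i), hPc.comp_clm (star (S i))⟩,
    fun j => ⟨InnerProductSpace.rankOne ℂ g (f j), isCompactOperator_rankOne _ _⟩,
    fun i j => ?_, ?_, ?_, ?_, ?_⟩
  · change ‖(a i j : L →L[ℂ] L) - P * star T * diamond ι (P * star (S i))
      (InnerProductSpace.rankOne ℂ g (f j)) * ∑ k, ∑ l, S l * (S k * (a k l : L →L[ℂ] L))‖ ≤ ε
    have : P * star T * diamond ι (P * star (S i)) (InnerProductSpace.rankOne ℂ g (f j))
        * ∑ k, ∑ l, S l * (S k * (a k l : L →L[ℂ] L)) = P * a i j := by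
      rw [diamond_rankOne, ← hTdef]
      change P * star T * (T * (P * star (S i)) * star (S j)) * _ = _
      rw [← hSSy i j]
      calc _ = P * (star T * T) * P * (star (S i) * (star (S j)
            * ∑ k, ∑ l, S l * (S k * (a k l : L →L[ℂ] L)))) := by simp only [mul_assoc]
        _ = _ := by rw [hT, mul_one, hPP]
    rw [this]
    exact h (i, j)
  · change ‖P * star T‖ ≤ 1
    have hT1 : ‖T‖ ≤ 1 := hg ▸ norm_slot_le ι g
    calc _ ≤ ‖P‖ * ‖star T‖ := norm_mul_le _ _
      _ ≤ 1 * 1 := mul_le_mul hP.norm_le (by rwa [norm_star]) (norm_nonneg _) zero_le_one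
      _ = 1 := one_mul 1
  · have := norm_sum_mul_star_le_one Finset.univ (fun i => S i * P) P (fun i j => by
      rw [star_mul, hPs, mul_assoc, ← mul_assoc (star (S i)), hS]
      split_ifs <;> simp [hPP]) (fun i => by rw [mul_assoc, hPP])
    simpa only [star_mul, star_star, hPs] using this
  · have hr : ∀ u v : L, star (InnerProductSpace.rankOne ℂ u v) = InnerProductSpace.rankOne ℂ v u :=
      fun u v => by rw [ContinuousLinearMap.star_eq_adjoint, InnerProductSpace.adjoint_rankOne]
    have hm : ∀ u v w z : L, InnerProductSpace.rankOne ℂ u v * InnerProductSpace.rankOne ℂ w z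
        = inner ℂ v w • InnerProductSpace.rankOne ℂ u z :=
      fun u v w z => InnerProductSpace.rankOne_comp_rankOne u v w z
    have hgg : inner ℂ g g = (1 : ℂ) := by rw [inner_self_eq_norm_sq_to_K, hg]; simp
    have := norm_sum_mul_star_le_one Finset.univ
      (fun i => InnerProductSpace.rankOne ℂ (f i) g) (InnerProductSpace.rankOne ℂ g g)
      (fun i j => by
        rw [hr, hm, orthonormal_iff_ite.mp hf]
        split_ifs <;> simp) (fun i => by rw [hm, hgg, one_smul])
    simpa only [hr] using this
  · change ‖(∑ i, ∑ j, S j * (S i * a i j) : L →L[ℂ] L)‖ ^ 2 ≤ _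
    refine (le_of_eq ?_)
    rw [sq, ← CStarRing.norm_star_mul_self]
    congr 1
    nth_rw 1 [star_sum]
    rw [Finset.sum_mul]
    refine Finset.sum_congr rfl fun i _ => ?_
    rw [star_sum, Finset.sum_mul]
    refine Finset.sum_congr rfl fun j _ => ?_
    rw [star_mul, star_mul, mul_assoc, mul_assoc, hSSy]

/-- The adjoint of a compact operator, as a compact operator. -/
noncomputable def starK (a : KOp L) : KOp L := ⟨star (a : L →L[ℂ] L), isCompactOperator_star a.2⟩

theorem coe_starK (a : KOp L) : (starK a : L →L[ℂ] L) = star (a : L →L[ℂ] L) := rfl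

theorem norm_starK (a : KOp L) : ‖starK a‖ = ‖a‖ := norm_star (a : L →L[ℂ] L)

/-- The row version of `exists_column_mul_factorization`: the adjoints of a column factorization of
the transposed family of adjoints, in reverse order. -/
theorem exists_row_mul_factorization (ι : L ≃ₗᵢ[ℂ] HTensor L L)
    (hL : ¬ FiniteDimensional ℂ L) {n : ℕ}
    (a : Fin n → Fin n → KOp L) {ε : ℝ} (hε : 0 < ε) :
    ∃ p q : Fin n → KOp L, (∀ i j, ‖a i j - mulK (p i) (q j)‖ ≤ ε) ∧
      ‖∑ j, (q j : L →L[ℂ] L) * star (q j : L →L[ℂ] L)‖ ≤ 1 ∧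
      ‖∑ i, (p i : L →L[ℂ] L) * star (p i : L →L[ℂ] L)‖
        ≤ ‖∑ i, ∑ j, (a i j : L →L[ℂ] L) * star (a i j : L →L[ℂ] L)‖ := by
  obtain ⟨p, q, h, hp, hq⟩ :=
    exists_column_mul_factorization ι hL (fun i j => starK (a j i)) hε
  refine ⟨fun i => starK (q i), fun j => starK (p j), fun i j => ?_, ?_, ?_⟩
  · refine le_of_eq_of_le ?_ (h j i)
    rw [← norm_starK]
    congr 1
    refine Subtype.ext ?_
    change star ((a i j : L →L[ℂ] L) - star (q i : L →L[ℂ] L) * star (p j : L →L[ℂ] L))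
      = star (a i j : L →L[ℂ] L) - p j * q i
    rw [star_sub, star_mul, star_star, star_star]
  · simpa only [coe_starK, star_star] using hp
  · rw [Finset.sum_comm (f := fun i j => (a i j : L →L[ℂ] L) * star (a i j : L →L[ℂ] L))]
    simpa only [coe_starK, star_star] using hq

/-- The row version of `exists_column_diamond_factorization`. Since `⋄` commutes with the adjoint
without a change of order, no transposition is needed. -/
theorem exists_row_diamond_factorization (ι : L ≃ₗᵢ[ℂ] HTensor L L)
    (hL : ¬ FiniteDimensional ℂ L) {n : ℕ}
    (a : Fin n → Fin n → KOp L) {ε : ℝ} (hε : 0 < ε) :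
    ∃ (x y : KOp L) (p q : Fin n → KOp L),
      (∀ i j, ‖(a i j : L →L[ℂ] L) - x * diamond ι (p i) (q j) * y‖ ≤ ε) ∧ ‖y‖ ≤ 1 ∧
      ‖∑ i, (p i : L →L[ℂ] L) * star (p i : L →L[ℂ] L)‖ ≤ 1 ∧
      ‖∑ i, (q i : L →L[ℂ] L) * star (q i : L →L[ℂ] L)‖ ≤ 1 ∧
      ‖x‖ ^ 2 ≤ ‖∑ i, ∑ j, (a i j : L →L[ℂ] L) * star (a i j : L →L[ℂ] L)‖ := by
  obtain ⟨x, y, p, q, h, hx, hp, hq, hy⟩ :=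
    exists_column_diamond_factorization ι hL (fun i j => starK (a i j)) hε
  refine ⟨starK y, starK x, fun i => starK (p i), fun i => starK (q i), fun i j => ?_, ?_, ?_,
    ?_, ?_⟩
  · refine le_of_eq_of_le ?_ (h i j)
    rw [← norm_star]
    congr 1
    simp only [coe_starK, star_sub, star_mul, star_diamond, star_star, mul_assoc]
  · rwa [norm_starK]
  · simpa only [coe_starK, star_star] using hp
  · simpa only [coe_starK, star_star] using hq
  · rw [norm_starK]
    simpa only [coe_starK, star_star] using hy

end Factorization

/-! ### Concrete norms -/

section Orthogonal

variable {H₁ K₁ : Type*} [NormedAddCommGroup H₁] [InnerProductSpace ℂ H₁] [CompleteSpace H₁]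

theorem inner_eq_zero_of_mul_eq_zero {r s : H₁ →L[ℂ] H₁} (hr : IsStarProjection r)
    (hrs : r * s = 0) (x y : H₁) : inner ℂ (r x) (s y) = 0 := by
  have : inner ℂ (r x) (s y) = inner ℂ x (r (s y)) := by
    conv_lhs => rw [← hr.isSelfAdjoint.star_eq]
    rw [ContinuousLinearMap.star_eq_adjoint, ContinuousLinearMap.adjoint_inner_left]
  rw [this, ← mul_apply_eq_comp, hrs]
  simp

variable [NormedAddCommGroup K₁] [InnerProductSpace ℂ K₁] [CompleteSpace K₁]

/-- The norm of a sum of operators with orthogonal initial spaces and orthogonal final spaces. -/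
theorem norm_add_eq_max_of_orthogonal {X Y : H₁ →L[ℂ] K₁}
    {p q : H₁ →L[ℂ] H₁} {p' q' : K₁ →L[ℂ] K₁}
    (hp : IsStarProjection p) (hq : IsStarProjection q) (hp' : IsStarProjection p')
    (hq' : IsStarProjection q') (hpq : p * q = 0) (hpq' : p' * q' = 0)
    (hX' : p' ∘L X = X) (hX : X ∘L p = X) (hY' : q' ∘L Y = Y) (hY : Y ∘L q = Y) :
    ‖X + Y‖ = max ‖X‖ ‖Y‖ := by
  have hqp' : q' * p' = 0 := by
    have := congrArg star hpq'
    rwa [star_mul, hp'.isSelfAdjoint.star_eq, hq'.isSelfAdjoint.star_eq, star_zero] at this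
  have hproj : IsStarProjection (p + q) := hp.add hq hpq
  refine le_antisymm ?_ (max_le ?_ ?_)
  · refine ContinuousLinearMap.opNorm_le_bound _ (le_max_of_le_left (norm_nonneg X)) fun z => ?_
    set m := max ‖X‖ ‖Y‖
    have e1 : ‖X z + Y z‖ ^ 2 = ‖X z‖ ^ 2 + ‖Y z‖ ^ 2 := by
      rw [sq, sq, sq]
      refine norm_add_sq_eq_norm_sq_add_norm_sq_of_inner_eq_zero (𝕜 := ℂ) _ _ ?_
      rw [← hX', ← hY']
      exact inner_eq_zero_of_mul_eq_zero hp' hpq' _ _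
    have e2 : ‖(p + q) z‖ ^ 2 = ‖p z‖ ^ 2 + ‖q z‖ ^ 2 := by
      rw [sq, sq, sq, add_apply]
      exact norm_add_sq_eq_norm_sq_add_norm_sq_of_inner_eq_zero (𝕜 := ℂ) _ _
        (inner_eq_zero_of_mul_eq_zero hp hpq _ _)
    have e3 : ‖(p + q) z‖ ≤ ‖z‖ :=
      ((p + q).le_opNorm z).trans (mul_le_of_le_one_left (norm_nonneg z) hproj.norm_le)
    have e4 : ‖X z‖ ≤ m * ‖p z‖ := by
      rw [← hX]
      exact (X.le_opNorm _).trans (mul_le_mul_of_nonneg_right (le_max_left _ _) (norm_nonneg _))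
    have e5 : ‖Y z‖ ≤ m * ‖q z‖ := by
      rw [← hY]
      exact (Y.le_opNorm _).trans (mul_le_mul_of_nonneg_right (le_max_right _ _) (norm_nonneg _))
    have hm : 0 ≤ m := le_max_of_le_left (norm_nonneg X)
    rw [add_apply]
    refine (pow_le_pow_iff_left₀ (norm_nonneg _) (by positivity) two_ne_zero).mp ?_
    calc ‖X z + Y z‖ ^ 2 = ‖X z‖ ^ 2 + ‖Y z‖ ^ 2 := e1
      _ ≤ (m * ‖p z‖) ^ 2 + (m * ‖q z‖) ^ 2 := by gcongr
      _ = m ^ 2 * ‖(p + q) z‖ ^ 2 := by rw [e2]; ring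
      _ ≤ m ^ 2 * ‖z‖ ^ 2 := by gcongr
      _ = (m * ‖z‖) ^ 2 := by ring
  · have : X = p' ∘L (X + Y) := by
      rw [ContinuousLinearMap.comp_add, hX', ← hY', ← ContinuousLinearMap.comp_assoc]
      change X = X + (p' * q') ∘L Y
      rw [hpq', ContinuousLinearMap.zero_comp, add_zero]
    conv_lhs => rw [this]
    exact (ContinuousLinearMap.opNorm_comp_le _ _).trans
      (mul_le_of_le_one_left (norm_nonneg _) hp'.norm_le)
  · have : Y = q' ∘L (X + Y) := by
      rw [ContinuousLinearMap.comp_add, hY', ← hX', ← ContinuousLinearMap.comp_assoc]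
      change Y = (q' * p') ∘L X + Y
      rw [hqp', ContinuousLinearMap.zero_comp, zero_add]
    conv_lhs => rw [this]
    exact (ContinuousLinearMap.opNorm_comp_le _ _).trans
      (mul_le_of_le_one_left (norm_nonneg _) hq'.norm_le)

end Orthogonal

section Concrete

variable {L : Type*} [NormedAddCommGroup L] [InnerProductSpace ℂ L]
  {E : Type*} [AddCommGroup E] [Module ℂ E]
  {H₁ K₁ : Type*} [NormedAddCommGroup H₁] [InnerProductSpace ℂ H₁]
  [NormedAddCommGroup K₁] [InnerProductSpace ℂ K₁]

/-- The amplification `a ⊗ x ↦ a ⊗ I x` of an embedding `I` into the bounded operators; the concrete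
norm is the operator norm of its values. -/
noncomputable def concreteMap (L : Type*) [NormedAddCommGroup L] [InnerProductSpace ℂ L]
    (I : E →ₗ[ℂ] (H₁ →L[ℂ] K₁)) : Amp L E →ₗ[ℂ] (HTensor L H₁ →L[ℂ] HTensor L K₁) :=
  TensorProduct.lift ((hmapₗ (H₁ := L) (K₁ := L) (H₂ := H₁) (K₂ := K₁)).compl₁₂ (KOp L).subtype I)

variable (I : E →ₗ[ℂ] (H₁ →L[ℂ] K₁))

theorem concreteNorm_eq (u : Amp L E) : concreteNorm L I u = ‖concreteMap L I u‖ := rfl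

theorem concreteMap_tmul (a : KOp L) (x : E) :
    concreteMap L I (a ⊗ₜ x) = hmap (a : L →L[ℂ] L) (I x) := rfl

theorem lact_tmul (b : L →L[ℂ] L) (a : KOp L) (x : E) :
    lact b (a ⊗ₜ[ℂ] x) = mulLeftK b a ⊗ₜ x := rfl

theorem ract_tmul (b : L →L[ℂ] L) (a : KOp L) (x : E) :
    ract b (a ⊗ₜ[ℂ] x) = mulRightK b a ⊗ₜ x := rfl

theorem concreteMap_lact (b : L →L[ℂ] L) (u : Amp L E) :
    concreteMap L I (lact b u) = hmap b (.id ℂ K₁) ∘L concreteMap L I u := by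
  induction u using TensorProduct.induction_on with
  | zero => simp
  | tmul a x =>
    rw [lact_tmul, concreteMap_tmul, concreteMap_tmul, ← hmap_comp, ContinuousLinearMap.id_comp]
    rfl
  | add u v hu hv => rw [map_add, map_add, hu, hv, map_add, ContinuousLinearMap.comp_add]

theorem concreteMap_ract (b : L →L[ℂ] L) (u : Amp L E) :
    concreteMap L I (ract b u) = concreteMap L I u ∘L hmap b (.id ℂ H₁) := by
  induction u using TensorProduct.induction_on with
  | zero => simp
  | tmul a x =>
    rw [ract_tmul, concreteMap_tmul, concreteMap_tmul, ← hmap_comp, ContinuousLinearMap.comp_id]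
    rfl
  | add u v hu hv => rw [map_add, map_add, hu, hv, map_add, ContinuousLinearMap.add_comp]

theorem norm_hmap_id_le (b : L →L[ℂ] L) : ‖hmap b (.id ℂ H₁)‖ ≤ ‖b‖ :=
  (norm_hmap_le _ _).trans
    (mul_le_of_le_one_right (norm_nonneg b) ContinuousLinearMap.norm_id_le)

/-- The matrix coefficient `a ↦ ⟪ζ, a ξ⟫` of compact operators. -/
noncomputable def matrixCoeff (ζ ξ : L) : KOp L →ₗ[ℂ] ℂ where
  toFun a := inner ℂ ζ ((a : L →L[ℂ] L) ξ)
  map_add' a b := inner_add_right ζ ((a : L →L[ℂ] L) ξ) ((b : L →L[ℂ] L) ξ)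
  map_smul' c a := inner_smul_right ζ ((a : L →L[ℂ] L) ξ) c

/-- The slice of `u` by a matrix coefficient can be read off from the amplification of `u`. -/
theorem inner_concreteMap (ζ ξ : L) (η : H₁) (κ : K₁) (u : Amp L E) :
    inner ℂ (toHTensor (ζ ⊗ₜ[ℂ] κ)) (concreteMap L I u (toHTensor (ξ ⊗ₜ η)))
      = inner ℂ κ (I (TensorProduct.lid ℂ E ((matrixCoeff ζ ξ).rTensor E u)) η) := by
  induction u using TensorProduct.induction_on with
  | zero => simp
  | tmul a x =>
    rw [concreteMap_tmul, hmap_tmul, inner_toHTensor_tmul, LinearMap.rTensor_tmul,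
      TensorProduct.lid_tmul, map_smul, smul_apply, inner_smul_right]
    rfl
  | add u v hu hv => simp only [map_add, add_apply, inner_add_right, hu, hv]

/-- If the amplification of `u` vanishes, so do all slices of `u` by matrix coefficients. Along a
basis of `E`, the coefficients of `u` are then operators all of whose matrix coefficients vanish. -/
theorem concreteMap_injective (hI : Function.Injective I) :
    Function.Injective (concreteMap L I) := by
  refine (injective_iff_map_eq_zero _).mpr fun u hu => ?_
  have hslice : ∀ ζ ξ : L, TensorProduct.lid ℂ E ((matrixCoeff ζ ξ).rTensor E u) = 0 := by
    intro ζ ξ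
    refine hI ?_
    rw [map_zero]
    refine ContinuousLinearMap.ext fun η => ext_inner_left ℂ fun κ => ?_
    rw [← inner_concreteMap, hu]
    simp
  let b := Module.Basis.ofVectorSpace ℂ E
  obtain ⟨c, rfl⟩ := TensorProduct.eq_repr_basis_right b u
  refine Finset.sum_eq_zero fun i hi => ?_
  have hc : c i = 0 := by
    refine Subtype.ext (ContinuousLinearMap.ext fun ξ => ext_inner_left ℂ fun ζ => ?_)
    have h := hslice ζ ξ
    simp only [Finsupp.sum, map_sum, LinearMap.rTensor_tmul, TensorProduct.lid_tmul] at h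
    have := linearIndependent_iff'.mp b.linearIndependent c.support _ h i hi
    rw [Submodule.coe_zero, zero_apply, inner_zero_right]
    exact this
  rw [hc]
  exact TensorProduct.zero_tmul _ _

theorem hmap_id_mul_hmap_id {P Q : L →L[ℂ] L} (hPQ : P * Q = 0) :
    hmap P (.id ℂ H₁) * hmap Q (.id ℂ H₁) = 0 := by
  change hmap P _ ∘L hmap Q _ = 0
  rw [← hmap_comp]
  change hmap (P * Q) _ = 0
  rw [hPQ, hmap_zero_left]

theorem norm_hmap_id [Nontrivial H₁] (a : L →L[ℂ] L) : ‖hmap a (.id ℂ H₁)‖ = ‖a‖ := by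
  refine le_antisymm (norm_hmap_id_le a)
    (ContinuousLinearMap.opNorm_le_bound _ (norm_nonneg _) fun ξ => ?_)
  obtain ⟨η, hη⟩ := exists_norm_eq H₁ (zero_le_one (α := ℝ))
  have := (hmap a (.id ℂ H₁)).le_opNorm (toHTensor (ξ ⊗ₜ η))
  rw [hmap_tmul, norm_toHTensor_tmul, norm_toHTensor_tmul, ContinuousLinearMap.id_apply, hη,
    mul_one, mul_one] at this
  exact this

variable [CompleteSpace L] [CompleteSpace H₁]

theorem isStarProjection_hmap_id {P : L →L[ℂ] L} (hP : IsStarProjection P) :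
    IsStarProjection (hmap P (.id ℂ H₁)) := by
  refine ⟨?_, ?_⟩
  · change hmap P _ ∘L hmap P _ = _
    rw [← hmap_comp, ContinuousLinearMap.id_comp]
    exact congrArg (hmap · _) hP.isIdempotentElem
  · change star _ = _
    rw [ContinuousLinearMap.star_eq_adjoint, adjoint_hmap, ContinuousLinearMap.adjoint_id,
      ← ContinuousLinearMap.star_eq_adjoint, hP.isSelfAdjoint.star_eq]

variable [CompleteSpace K₁]

theorem isQuantumNorm_concreteNorm (hI : Function.Injective I) :
    IsQuantumNorm (concreteNorm L I) where
  add_le u v := by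
    rw [concreteNorm_eq, map_add]
    exact norm_add_le (concreteMap L I u) _
  smul_eq c u := by
    rw [concreteNorm_eq, map_smul, norm_smul]
    rfl
  eq_zero_of_norm_eq_zero u hu :=
    concreteMap_injective I hI ((norm_eq_zero.mp hu).trans (map_zero _).symm)
  lact_le b u := by
    rw [concreteNorm_eq, concreteMap_lact]
    exact (ContinuousLinearMap.opNorm_comp_le _ _).trans
      (mul_le_mul_of_nonneg_right (norm_hmap_id_le b) (norm_nonneg _))
  ract_le b u := by
    rw [concreteNorm_eq, concreteMap_ract, mul_comm ‖b‖]
    exact (ContinuousLinearMap.opNorm_comp_le _ _).trans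
      (mul_le_mul_of_nonneg_left (norm_hmap_id_le b) (norm_nonneg _))
  add_eq_max P Q u v hP hQ hPQ hPu huP hQv hvQ := by
    rw [concreteNorm_eq, map_add]
    refine norm_add_eq_max_of_orthogonal (isStarProjection_hmap_id hP)
      (isStarProjection_hmap_id hQ) (isStarProjection_hmap_id hP) (isStarProjection_hmap_id hQ)
      (hmap_id_mul_hmap_id hPQ) (hmap_id_mul_hmap_id hPQ) ?_ ?_ ?_ ?_
    · rw [← concreteMap_lact, hPu]
    · rw [← concreteMap_ract, huP]
    · rw [← concreteMap_lact, hQv]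
    · rw [← concreteMap_ract, hvQ]

/-- If the operators `I (x k)` are isometries with orthogonal ranges, the concrete norm of
`∑ a k ⊗ x k` is the norm of the column of the `a k`. -/
theorem concreteNorm_sq_of_adjoint_comp [Nontrivial H₁] {κ : Type*} [Fintype κ] [DecidableEq κ]
    (x : κ → E) (hx : ∀ i j, (I (x i)).adjoint ∘L I (x j) = if i = j then .id ℂ H₁ else 0)
    (a : κ → KOp L) :
    concreteNorm L I (∑ k, a k ⊗ₜ x k) ^ 2 = ‖∑ k, star (a k : L →L[ℂ] L) * a k‖ := by
  rw [concreteNorm_eq, sq, ← ContinuousLinearMap.norm_adjoint_comp_self,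
    ← norm_hmap_id (H₁ := H₁) (∑ k, star (a k : L →L[ℂ] L) * (a k : L →L[ℂ] L))]
  congr 1
  rw [map_sum, map_sum, hmap_sum_left, ContinuousLinearMap.finsetSum_comp]
  refine Finset.sum_congr rfl fun i _ => ?_
  rw [ContinuousLinearMap.comp_finsetSum, Finset.sum_eq_single i]
  · rw [concreteMap_tmul, adjoint_hmap, ← hmap_comp, hx, if_pos rfl]
    rfl
  · intro j _ hj
    rw [concreteMap_tmul, concreteMap_tmul, adjoint_hmap, ← hmap_comp, hx, if_neg hj.symm,
      hmap_zero_right]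
  · simp

/-- If the operators `I (x k)` are coisometries with orthogonal initial spaces, the concrete norm
of `∑ a k ⊗ x k` is the norm of the row of the `a k`. -/
theorem concreteNorm_sq_of_comp_adjoint [Nontrivial K₁] {κ : Type*} [Fintype κ] [DecidableEq κ]
    (x : κ → E) (hx : ∀ i j, I (x i) ∘L (I (x j)).adjoint = if i = j then .id ℂ K₁ else 0)
    (a : κ → KOp L) :
    concreteNorm L I (∑ k, a k ⊗ₜ x k) ^ 2
      = ‖∑ k, (a k : L →L[ℂ] L) * star (a k : L →L[ℂ] L)‖ := by
  rw [concreteNorm_eq, ← LinearIsometryEquiv.norm_map ContinuousLinearMap.adjoint, sq,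
    ← ContinuousLinearMap.norm_adjoint_comp_self, ContinuousLinearMap.adjoint_adjoint,
    ← norm_hmap_id (H₁ := K₁) (∑ k, (a k : L →L[ℂ] L) * star (a k : L →L[ℂ] L))]
  congr 1
  rw [map_sum, map_sum, hmap_sum_left, ContinuousLinearMap.finsetSum_comp]
  refine Finset.sum_congr rfl fun i _ => ?_
  rw [ContinuousLinearMap.comp_finsetSum, Finset.sum_eq_single i]
  · rw [concreteMap_tmul, adjoint_hmap, ← hmap_comp, hx, if_pos rfl]
    rfl
  · intro j _ hj
    rw [concreteMap_tmul, concreteMap_tmul, adjoint_hmap, ← hmap_comp, hx, if_neg hj.symm,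
      hmap_zero_right]
  · simp

end Concrete

/-! ### Expansions along orthonormal families -/

section Expansion

variable {A M : Type*} [AddCommGroup A] [Module ℂ A] [AddCommGroup M] [Module ℂ M]

/-- There is a finite set `s` of vectors such that `u` has an expansion along each family whose span
contains `s`. That all such families are allowed makes the statement additive in `u`. -/
theorem exists_finite_expansion (u : A ⊗[ℂ] M) : ∃ s : Set M, s.Finite ∧
    ∀ (n : ℕ) (e : Fin n → M), s ⊆ Submodule.span ℂ (Set.range e) →
      ∃ a : Fin n → A, u = ∑ i, a i ⊗ₜ e i := by
  induction u using TensorProduct.induction_on with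
  | zero => exact ⟨∅, Set.finite_empty, fun n e _ => ⟨0, by simp⟩⟩
  | tmul b x =>
    refine ⟨{x}, Set.finite_singleton x, fun n e he => ?_⟩
    obtain ⟨c, rfl⟩ := Submodule.mem_span_range_iff_exists_fun ℂ |>.mp (he rfl)
    exact ⟨fun i => c i • b, by simp only [TensorProduct.tmul_sum, TensorProduct.smul_tmul]⟩
  | add u v hu hv =>
    obtain ⟨s, hs, hs'⟩ := hu
    obtain ⟨t, ht, ht'⟩ := hv
    refine ⟨s ∪ t, hs.union ht, fun n e he => ?_⟩
    obtain ⟨a, rfl⟩ := hs' n e (Set.subset_union_left.trans he)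
    obtain ⟨b, rfl⟩ := ht' n e (Set.subset_union_right.trans he)
    exact ⟨a + b, by simp only [Pi.add_apply, TensorProduct.add_tmul, Finset.sum_add_distrib]⟩

theorem exists_finite_expansion_square (u : A ⊗[ℂ] (M ⊗[ℂ] M)) : ∃ s : Set M, s.Finite ∧
    ∀ (n : ℕ) (e : Fin n → M), s ⊆ Submodule.span ℂ (Set.range e) →
      ∃ a : Fin n → Fin n → A, u = ∑ i, ∑ j, a i j ⊗ₜ (e i ⊗ₜ[ℂ] e j) := by
  induction u using TensorProduct.induction_on with
  | zero => exact ⟨∅, Set.finite_empty, fun n e _ => ⟨0, by simp⟩⟩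
  | tmul b z =>
    obtain ⟨s, hs, h⟩ : ∃ s : Set M, s.Finite ∧
        ∀ (n : ℕ) (e : Fin n → M), s ⊆ Submodule.span ℂ (Set.range e) →
          ∃ c : Fin n → Fin n → ℂ, z = ∑ i, ∑ j, c i j • (e i ⊗ₜ[ℂ] e j) := by
      induction z using TensorProduct.induction_on with
      | zero => exact ⟨∅, Set.finite_empty, fun n e _ => ⟨0, by simp⟩⟩
      | tmul x y =>
        refine ⟨{x, y}, Set.toFinite _, fun n e he => ?_⟩
        obtain ⟨c, rfl⟩ := Submodule.mem_span_range_iff_exists_fun ℂ |>.mp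
          (he (Set.mem_insert x _))
        obtain ⟨d, rfl⟩ := Submodule.mem_span_range_iff_exists_fun ℂ |>.mp
          (he (Set.mem_insert_of_mem _ rfl))
        refine ⟨fun i j => c i * d j, ?_⟩
        simp only [TensorProduct.sum_tmul, TensorProduct.tmul_sum, TensorProduct.smul_tmul_smul]
        exact Finset.sum_comm
      | add z w hz hw =>
        obtain ⟨s, hs, hs'⟩ := hz
        obtain ⟨t, ht, ht'⟩ := hw
        refine ⟨s ∪ t, hs.union ht, fun n e he => ?_⟩
        obtain ⟨c, rfl⟩ := hs' n e (Set.subset_union_left.trans he)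
        obtain ⟨d, rfl⟩ := ht' n e (Set.subset_union_right.trans he)
        exact ⟨c + d, by simp only [Pi.add_apply, add_smul, Finset.sum_add_distrib]⟩
    refine ⟨s, hs, fun n e he => ?_⟩
    obtain ⟨c, rfl⟩ := h n e he
    exact ⟨fun i j => c i j • b, by simp only [TensorProduct.tmul_sum, TensorProduct.smul_tmul]⟩
  | add u v hu hv =>
    obtain ⟨s, hs, hs'⟩ := hu
    obtain ⟨t, ht, ht'⟩ := hv
    refine ⟨s ∪ t, hs.union ht, fun n e he => ?_⟩
    obtain ⟨a, rfl⟩ := hs' n e (Set.subset_union_left.trans he)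
    obtain ⟨b, rfl⟩ := ht' n e (Set.subset_union_right.trans he)
    exact ⟨a + b, by simp only [Pi.add_apply, TensorProduct.add_tmul, Finset.sum_add_distrib]⟩

variable {H : Type*} [NormedAddCommGroup H] [InnerProductSpace ℂ H]

theorem exists_orthonormal_span {s : Set H} (hs : s.Finite) :
    ∃ (n : ℕ) (e : Fin n → H), Orthonormal ℂ e ∧ s ⊆ Submodule.span ℂ (Set.range e) := by
  have : FiniteDimensional ℂ (Submodule.span ℂ s) := FiniteDimensional.span_of_finite ℂ hs
  let b := stdOrthonormalBasis ℂ (Submodule.span ℂ s)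
  refine ⟨_, fun i => (b i : H), b.orthonormal.comp_linearIsometry (Submodule.subtypeₗᵢ _),
    fun x hx => ?_⟩
  refine (Submodule.mem_span_range_iff_exists_fun ℂ).mpr
    ⟨fun i => b.repr ⟨x, Submodule.subset_span hx⟩ i, ?_⟩
  have := congrArg Subtype.val (b.sum_repr ⟨x, Submodule.subset_span hx⟩)
  simpa using this

theorem exists_orthonormal_expansion_square (U : A ⊗[ℂ] (H ⊗[ℂ] H)) :
    ∃ (n : ℕ) (e : Fin n → H) (a : Fin n → Fin n → A), Orthonormal ℂ e ∧
      U = ∑ i, ∑ j, a i j ⊗ₜ (e i ⊗ₜ[ℂ] e j) := by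
  obtain ⟨s, hs, h⟩ := exists_finite_expansion_square U
  obtain ⟨n, e, he, hse⟩ := exists_orthonormal_span hs
  obtain ⟨a, ha⟩ := h n e hse
  exact ⟨n, e, a, he, ha⟩

theorem exists_orthonormal_expansion_pair (u v : A ⊗[ℂ] H) :
    ∃ (n : ℕ) (e : Fin n → H) (a b : Fin n → A), Orthonormal ℂ e ∧
      u = ∑ i, a i ⊗ₜ e i ∧ v = ∑ i, b i ⊗ₜ e i := by
  obtain ⟨s, hs, h⟩ := exists_finite_expansion u
  obtain ⟨t, ht, h'⟩ := exists_finite_expansion v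
  obtain ⟨n, e, he, hse⟩ := exists_orthonormal_span (hs.union ht)
  obtain ⟨a, ha⟩ := h n e (Set.subset_union_left.trans hse)
  obtain ⟨b, hb⟩ := h' n e (Set.subset_union_right.trans hse)
  exact ⟨n, e, a, b, he, ha, hb⟩

end Expansion

/-! ### Representations and their cost -/

section Cost

variable {X T : Type*} [AddCommMonoid X] {g : T → X} {c : T → ℝ}

/-- `U` is a finite sum of elements `g t` whose total cost, as measured by `c`, is at most `r`. -/
def HasCost (g : T → X) (c : T → ℝ) (U : X) (r : ℝ) : Prop :=
  ∃ (n : ℕ) (t : Fin n → T), U = ∑ k, g (t k) ∧ ∑ k, c (t k) ≤ r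

theorem HasCost.mono {U : X} {r s : ℝ} (h : HasCost g c U r) (hrs : r ≤ s) : HasCost g c U s := by
  obtain ⟨n, t, hU, hr⟩ := h
  exact ⟨n, t, hU, hr.trans hrs⟩

theorem hasCost_zero : HasCost g c 0 0 := ⟨0, Fin.elim0, by simp, by simp⟩

theorem hasCost_single (t : T) : HasCost g c (g t) (c t) := ⟨1, fun _ => t, by simp, by simp⟩

theorem HasCost.add {U V : X} {r s : ℝ} (h : HasCost g c U r) (h' : HasCost g c V s) :
    HasCost g c (U + V) (r + s) := by
  obtain ⟨n, t, rfl, hr⟩ := h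
  obtain ⟨m, w, rfl, hs⟩ := h'
  exact ⟨n + m, Fin.append t w, by simp [Fin.sum_univ_add],
    by simpa [Fin.sum_univ_add] using add_le_add hr hs⟩

theorem hasCost_sum {κ : Type*} (s : Finset κ) {U : κ → X} {r : κ → ℝ}
    (h : ∀ k, HasCost g c (U k) (r k)) : HasCost g c (∑ k ∈ s, U k) (∑ k ∈ s, r k) := by
  classical
  induction s using Finset.induction_on with
  | empty => simpa using hasCost_zero
  | insert k s hk ih =>
    rw [Finset.sum_insert hk, Finset.sum_insert hk]
    exact (h k).add ih

/-- The infimum of the costs of all representations is `M`, if `M` is subadditive, at most the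
cost on each single piece, and attained up to `ε`. -/
theorem sInf_cost_eq {M : X → ℝ} (hc : ∀ t, 0 ≤ c t) (h0 : M 0 ≤ 0)
    (hadd : ∀ u v, M (u + v) ≤ M u + M v) (hM : ∀ t, M (g t) ≤ c t) {U : X}
    (hU : ∀ ε > 0, HasCost g c U (M U + ε)) :
    sInf {r : ℝ | ∃ (n : ℕ) (t : Fin n → T), U = ∑ k, g (t k) ∧ r = ∑ k, c (t k)} = M U := by
  refine le_antisymm (le_of_forall_pos_le_add fun ε hε => ?_) (le_csInf ?_ ?_)
  · obtain ⟨n, t, ht, hr⟩ := hU ε hε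
    refine le_trans (csInf_le ?_ ⟨n, t, ht, rfl⟩) hr
    refine ⟨0, ?_⟩
    rintro _ ⟨m, w, -, rfl⟩
    exact Finset.sum_nonneg fun k _ => hc _
  · obtain ⟨n, t, ht, -⟩ := hU 1 one_pos
    exact ⟨_, n, t, ht, rfl⟩
  · rintro _ ⟨n, t, rfl, rfl⟩
    exact (Finset.le_sum_of_subadditive M h0 hadd _ _).trans
      (Finset.sum_le_sum fun k _ => hM _)

variable {L : Type*} [NormedAddCommGroup L] [InnerProductSpace ℂ L]
  {H : Type*} [NormedAddCommGroup H] [InnerProductSpace ℂ H]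
  {g : T → Amp L (H ⊗[ℂ] H)}

/-- It suffices to represent elements at the optimal cost after a small perturbation of their
coefficients, if elementary tensors are represented at a cost proportional to their norm. -/
theorem hasCost_of_approx {M : Amp L (H ⊗[ℂ] H) → ℝ}
    (hcrude : ∀ (a : KOp L) (x y : H), ‖x‖ = 1 → ‖y‖ = 1 →
      HasCost g c (a ⊗ₜ (x ⊗ₜ[ℂ] y)) (4 * ‖a‖))
    (hsharp : ∀ (n : ℕ) (e : Fin n → H), Orthonormal ℂ e → ∀ (a : Fin n → Fin n → KOp L),
      ∀ ε > 0, ∃ a' : Fin n → Fin n → KOp L, (∀ i j, ‖a i j - a' i j‖ ≤ ε) ∧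
        HasCost g c (∑ i, ∑ j, a' i j ⊗ₜ (e i ⊗ₜ[ℂ] e j))
          (M (∑ i, ∑ j, a i j ⊗ₜ (e i ⊗ₜ[ℂ] e j))))
    (U : Amp L (H ⊗[ℂ] H)) {ε : ℝ} (hε : 0 < ε) : HasCost g c U (M U + ε) := by
  obtain ⟨n, e, a, he, rfl⟩ := exists_orthonormal_expansion_square U
  obtain ⟨a', ha', h⟩ := hsharp n e he a (ε / (4 * (n * n + 1))) (by positivity)
  have hrem := hasCost_sum Finset.univ fun i : Fin n => hasCost_sum Finset.univ fun j : Fin n =>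
    (hcrude (a i j - a' i j) (e i) (e j) (he.1 i) (he.1 j)).mono
      (mul_le_mul_of_nonneg_left (ha' i j) (by norm_num : (0 : ℝ) ≤ 4))
  have hsum : ∑ i, ∑ j, a i j ⊗ₜ[ℂ] (e i ⊗ₜ[ℂ] e j)
      = ∑ i, ∑ j, a' i j ⊗ₜ[ℂ] (e i ⊗ₜ[ℂ] e j)
        + ∑ i, ∑ j, (a i j - a' i j) ⊗ₜ[ℂ] (e i ⊗ₜ[ℂ] e j) := by
    simp only [← Finset.sum_add_distrib, ← TensorProduct.add_tmul, add_sub_cancel]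
  have hcost := h.add hrem
  rw [← hsum] at hcost
  refine hcost.mono (add_le_add_right ?_ _)
  simp only [Finset.sum_const, Finset.card_univ, Fintype.card_fin, nsmul_eq_mul]
  rw [show (n : ℝ) * (n * (4 * (ε / (4 * (n * n + 1))))) = ε * ((n * n) / (n * n + 1)) by
    field_simp]
  exact mul_le_of_le_one_right hε.le ((div_le_one (by positivity)).mpr (by linarith))

end Cost

/-! ### Columns and rows of compact operators -/

section Length

variable {L : Type*} [NormedAddCommGroup L] [InnerProductSpace ℂ L] [CompleteSpace L]

/-- The features that the squares `b ↦ b* b` and `b ↦ b b*` share. For a family `b` of compact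
operators, `‖∑ sq (b k)‖` is the square of the norm of the column, respectively the row, made of
the `b k`: it is submultiplicative for products and for `⋄`, and up to small perturbations each
doubly indexed family factors through products, or through `⋄`, without loss. -/
structure IsLengthSquare (ι : L ≃ₗᵢ[ℂ] HTensor L L) (sq : KOp L → L →L[ℂ] L) : Prop where
  norm_sq : ∀ b, ‖sq b‖ = ‖b‖ ^ 2
  mul_le : ∀ (n : ℕ) (p q : Fin n → KOp L),
    ‖∑ i, ∑ j, sq (mulK (p i) (q j))‖ ≤ ‖∑ i, sq (p i)‖ * ‖∑ j, sq (q j)‖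
  diamond_le : ∀ (n : ℕ) (p q : Fin n → KOp L),
    ‖∑ i, ∑ j, sq (diamondK ι (p i) (q j))‖ ≤ ‖∑ i, sq (p i)‖ * ‖∑ j, sq (q j)‖
  exists_mul : ∀ (n : ℕ) (a : Fin n → Fin n → KOp L), ∀ ε > 0, ∃ p q : Fin n → KOp L,
    (∀ i j, ‖a i j - mulK (p i) (q j)‖ ≤ ε) ∧
      ‖∑ i, sq (p i)‖ * ‖∑ j, sq (q j)‖ ≤ ‖∑ i, ∑ j, sq (a i j)‖
  exists_diamond : ∀ (n : ℕ) (a : Fin n → Fin n → KOp L), ∀ ε > 0,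
    ∃ (x y : KOp L) (p q : Fin n → KOp L),
      (∀ i j, ‖(a i j : L →L[ℂ] L) - x * diamond ι (p i) (q j) * y‖ ≤ ε) ∧
        ‖x‖ ^ 2 * ‖∑ i, sq (p i)‖ * ‖∑ j, sq (q j)‖ * ‖y‖ ^ 2 ≤ ‖∑ i, ∑ j, sq (a i j)‖

theorem isLengthSquare_column (hL : ¬ FiniteDimensional ℂ L) (ι : L ≃ₗᵢ[ℂ] HTensor L L) :
    IsLengthSquare ι fun b => star (b : L →L[ℂ] L) * b where
  norm_sq b := by rw [CStarRing.norm_star_mul_self, sq]; rfl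
  mul_le n p q := norm_sum_star_mul_mul_le Finset.univ Finset.univ
    (fun i => (p i : L →L[ℂ] L)) (fun j => (q j : L →L[ℂ] L))
  diamond_le n p q := by
    refine le_of_eq_of_le (congrArg norm ?_) (norm_diamond_le ι _ _)
    rw [diamond_sum_sum]
    simp only [coe_diamondK, star_diamond, diamond_mul_diamond]
  exists_mul n a ε hε := by
    obtain ⟨p, q, h, hp, hq⟩ := exists_column_mul_factorization ι hL a hε
    exact ⟨p, q, h, (mul_le_of_le_one_left (norm_nonneg _) hp).trans hq⟩
  exists_diamond n a ε hε := by
    obtain ⟨x, y, p, q, h, hx, hp, hq, hy⟩ := exists_column_diamond_factorization ι hL a hε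
    refine ⟨x, y, p, q, h, (mul_le_of_le_one_left (by positivity) ?_).trans hy⟩
    exact mul_le_one₀ (mul_le_one₀ (pow_le_one₀ (norm_nonneg _) hx) (norm_nonneg _) hp)
      (norm_nonneg _) hq

theorem isLengthSquare_row (hL : ¬ FiniteDimensional ℂ L) (ι : L ≃ₗᵢ[ℂ] HTensor L L) :
    IsLengthSquare ι fun b => (b : L →L[ℂ] L) * star (b : L →L[ℂ] L) where
  norm_sq b := by rw [CStarRing.norm_self_mul_star, sq]; rfl
  mul_le n p q := by
    have := norm_sum_star_mul_mul_le Finset.univ Finset.univ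
      (fun j => star (q j : L →L[ℂ] L)) (fun i => star (p i : L →L[ℂ] L))
    rw [Finset.sum_comm, mul_comm]
    simpa only [coe_mulK, star_mul, star_star] using this
  diamond_le n p q := by
    refine le_of_eq_of_le (congrArg norm ?_) (norm_diamond_le ι _ _)
    rw [diamond_sum_sum]
    simp only [coe_diamondK, star_diamond, diamond_mul_diamond]
  exists_mul n a ε hε := by
    obtain ⟨p, q, h, hq, hp⟩ := exists_row_mul_factorization ι hL a hε
    exact ⟨p, q, h, (mul_le_of_le_one_right (norm_nonneg _) hq).trans hp⟩
  exists_diamond n a ε hε := by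
    obtain ⟨x, y, p, q, h, hy, hp, hq, hx⟩ := exists_row_diamond_factorization ι hL a hε
    refine ⟨x, y, p, q, h, le_trans ?_ hx⟩
    rw [mul_assoc, mul_assoc]
    exact mul_le_of_le_one_right (by positivity) (mul_le_one₀ hp (by positivity)
      (mul_le_one₀ hq (by positivity) (pow_le_one₀ (norm_nonneg _) hy)))

end Length

/-! ### Bilinear operations on amplifications -/

section Operations

variable {L : Type*} [NormedAddCommGroup L] [InnerProductSpace ℂ L]
  {E F : Type*} [AddCommGroup E] [Module ℂ E] [AddCommGroup F] [Module ℂ F]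

theorem effros_tmul (a b : KOp L) (x : E) (y : F) :
    effros (a ⊗ₜ[ℂ] x) (b ⊗ₜ[ℂ] y) = mulK a b ⊗ₜ (x ⊗ₜ[ℂ] y) := rfl

theorem effros_sum_sum {n : ℕ} (p q : Fin n → KOp L) (e : Fin n → E) (f : Fin n → F) :
    effros (∑ i, p i ⊗ₜ[ℂ] e i) (∑ j, q j ⊗ₜ[ℂ] f j)
      = ∑ i, ∑ j, mulK (p i) (q j) ⊗ₜ[ℂ] (e i ⊗ₜ[ℂ] f j) := by
  rw [effros, LinearMap.map_sum₂]
  exact Finset.sum_congr rfl fun i _ => map_sum _ _ _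

theorem diamondAmp_tmul (ι : L ≃ₗᵢ[ℂ] HTensor L L) (a b : KOp L) (x : E) (y : F) :
    diamondAmp ι (a ⊗ₜ[ℂ] x) (b ⊗ₜ[ℂ] y) = diamondK ι a b ⊗ₜ (x ⊗ₜ[ℂ] y) := rfl

theorem diamondAmp_sum_sum (ι : L ≃ₗᵢ[ℂ] HTensor L L) {n : ℕ} (p q : Fin n → KOp L)
    (e : Fin n → E) (f : Fin n → F) :
    diamondAmp ι (∑ i, p i ⊗ₜ[ℂ] e i) (∑ j, q j ⊗ₜ[ℂ] f j)
      = ∑ i, ∑ j, diamondK ι (p i) (q j) ⊗ₜ[ℂ] (e i ⊗ₜ[ℂ] f j) := by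
  rw [diamondAmp, LinearMap.map_sum₂]
  exact Finset.sum_congr rfl fun i _ => map_sum _ _ _

end Operations

/-! ### The Haagerup and the operator-projective norm -/

section Comparison

variable {L : Type*} [NormedAddCommGroup L] [InnerProductSpace ℂ L]
  {H : Type*} [NormedAddCommGroup H] [InnerProductSpace ℂ H]

/-- `N` is computed along orthonormal families as the norm of a column or row of coefficients,
according to the choice of `sq`. -/
structure IsLengthNorm (sq : KOp L → L →L[ℂ] L) (N : Amp L H → ℝ) : Prop where
  nonneg : ∀ u, 0 ≤ N u
  sq_eq : ∀ (n : ℕ) (e : Fin n → H), Orthonormal ℂ e → ∀ a : Fin n → KOp L,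
    N (∑ i, a i ⊗ₜ e i) ^ 2 = ‖∑ i, sq (a i)‖

/-- `M` is computed along the products `e i ⊗ e j` of an orthonormal family as the norm of a column
or row of coefficients, according to the choice of `sq`. -/
structure IsSquareLengthNorm (sq : KOp L → L →L[ℂ] L) (M : Amp L (H ⊗[ℂ] H) → ℝ) : Prop where
  nonneg : ∀ U, 0 ≤ M U
  sq_eq : ∀ (n : ℕ) (e : Fin n → H), Orthonormal ℂ e → ∀ a : Fin n → Fin n → KOp L,
    M (∑ i, ∑ j, a i j ⊗ₜ (e i ⊗ₜ[ℂ] e j)) ^ 2 = ‖∑ i, ∑ j, sq (a i j)‖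

variable {ι : L ≃ₗᵢ[ℂ] HTensor L L} {sq : KOp L → L →L[ℂ] L} {N : Amp L H → ℝ}
  {M M' : Amp L (H ⊗[ℂ] H) → ℝ}

theorem IsSquareLengthNorm.eq (hM : IsSquareLengthNorm sq M) (hM' : IsSquareLengthNorm sq M') :
    M = M' := by
  ext U
  obtain ⟨n, e, a, he, rfl⟩ := exists_orthonormal_expansion_square U
  refine (pow_left_inj₀ (hM.nonneg _) (hM'.nonneg _) two_ne_zero).mp ?_
  rw [hM.sq_eq n e he, hM'.sq_eq n e he]

theorem IsLengthNorm.tmul (h : IsLengthSquare ι sq) (hN : IsLengthNorm sq N) (b : KOp L) {x : H}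
    (hx : ‖x‖ = 1) : N (b ⊗ₜ x) = ‖b‖ := by
  have he : Orthonormal ℂ (fun _ : Fin 1 => x) :=
    ⟨fun _ => hx, fun i j hij => (hij (Subsingleton.elim i j)).elim⟩
  refine (pow_left_inj₀ (hN.nonneg _) (norm_nonneg b) two_ne_zero).mp ?_
  have := hN.sq_eq 1 _ he (fun _ => b)
  simp only [Fin.sum_univ_one] at this
  rw [this, h.norm_sq]

theorem IsSquareLengthNorm.effros_le (h : IsLengthSquare ι sq) (hN : IsLengthNorm sq N)
    (hM : IsSquareLengthNorm sq M) (u v : Amp L H) : M (effros u v) ≤ N u * N v := by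
  obtain ⟨n, e, p, q, he, rfl, rfl⟩ := exists_orthonormal_expansion_pair u v
  refine (pow_le_pow_iff_left₀ (hM.nonneg _)
    (mul_nonneg (hN.nonneg _) (hN.nonneg _)) two_ne_zero).mp ?_
  rw [effros_sum_sum, hM.sq_eq n e he, mul_pow, hN.sq_eq n e he, hN.sq_eq n e he]
  exact h.mul_le n p q

theorem IsSquareLengthNorm.diamondAmp_le (h : IsLengthSquare ι sq) (hN : IsLengthNorm sq N)
    (hM : IsSquareLengthNorm sq M) (u v : Amp L H) : M (diamondAmp ι u v) ≤ N u * N v := by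
  obtain ⟨n, e, p, q, he, rfl, rfl⟩ := exists_orthonormal_expansion_pair u v
  refine (pow_le_pow_iff_left₀ (hM.nonneg _)
    (mul_nonneg (hN.nonneg _) (hN.nonneg _)) two_ne_zero).mp ?_
  rw [diamondAmp_sum_sum, hM.sq_eq n e he, mul_pow, hN.sq_eq n e he, hN.sq_eq n e he]
  exact h.diamond_le n p q

variable [CompleteSpace L]

theorem IsQuantumNorm.zero_le_zero {E : Type*} [AddCommGroup E] [Module ℂ E] {N : Amp L E → ℝ}
    (hN : IsQuantumNorm N) : N 0 ≤ 0 := by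
  have := hN.smul_eq 0 0
  rw [zero_smul, norm_zero, zero_mul] at this
  exact this.le

/-- Powers of `t` give the factorization `t ^ 4 = t² t²` into compact operators. -/
theorem hasCost_effros_tmul (h : IsLengthSquare ι sq) (hN : IsLengthNorm sq N) (a : KOp L) {x y : H}
    (hx : ‖x‖ = 1) (hy : ‖y‖ = 1) :
    HasCost (fun t : Amp L H × Amp L H => effros t.1 t.2) (fun t => N t.1 * N t.2)
      (a ⊗ₜ (x ⊗ₜ[ℂ] y)) (4 * ‖a‖) := by
  refine compact_induction (Φ := fun a r => HasCost (fun t : Amp L H × Amp L H => effros t.1 t.2)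
    (fun t => N t.1 * N t.2) (a ⊗ₜ (x ⊗ₜ[ℂ] y)) r) ?_ ?_ ?_ a
  · intro a b r s ha hb
    rw [TensorProduct.add_tmul]
    exact ha.add hb
  · exact fun a r s ha hrs => ha.mono hrs
  · intro z t a hz ha
    have ht : ‖mulK t t‖ ≤ ‖t‖ ^ 2 := by
      rw [pow_two]; exact norm_mul_le (t : L →L[ℂ] L) t
    have hat : a = mulK (z • mulK t t) (mulK t t) := by
      refine Subtype.ext ?_
      rw [ha, map_smul, LinearMap.smul_apply]
      change _ = z • ((t : L →L[ℂ] L) * t * (t * t))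
      rw [pow_succ, pow_succ, pow_two, mul_assoc]
    have := hasCost_single (g := fun t : Amp L H × Amp L H => effros t.1 t.2)
      (c := fun t => N t.1 * N t.2) ((z • mulK t t) ⊗ₜ x, mulK t t ⊗ₜ y)
    simp only [effros_tmul, ← hat] at this
    refine this.mono ?_
    simp only [hN.tmul h _ hx, hN.tmul h _ hy, norm_smul, hz, one_mul]
    calc _ ≤ ‖t‖ ^ 2 * ‖t‖ ^ 2 := mul_le_mul ht ht (norm_nonneg _) (by positivity)
      _ = ‖t‖ ^ 4 := by ring

/-- The Haagerup norm is the column or row norm on the tensor square: it dominates `M` by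
submultiplicativity, and the factorization through products shows that nothing is lost. -/
theorem haagerupNorm_eq (h : IsLengthSquare ι sq) (hN : IsLengthNorm sq N)
    (hM : IsSquareLengthNorm sq M) (hQ : IsQuantumNorm M) : haagerupNorm N N = M := by
  ext U
  let g : Amp L H × Amp L H → Amp L (H ⊗[ℂ] H) := fun t => effros t.1 t.2
  let c : Amp L H × Amp L H → ℝ := fun t => N t.1 * N t.2
  have hset : haagerupNorm N N U = sInf {r : ℝ | ∃ (n : ℕ) (t : Fin n → Amp L H × Amp L H),
      U = ∑ k, g (t k) ∧ r = ∑ k, c (t k)} := by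
    refine congrArg sInf (Set.ext fun r => ⟨?_, ?_⟩)
    · rintro ⟨n, u, v, hU, hr⟩
      exact ⟨n, fun k => (u k, v k), hU, hr⟩
    · rintro ⟨n, t, hU, hr⟩
      exact ⟨n, fun k => (t k).1, fun k => (t k).2, hU, hr⟩
  rw [hset]
  have hc : ∀ t, 0 ≤ c t := fun t => mul_nonneg (hN.nonneg _) (hN.nonneg _)
  have hg : ∀ t, M (g t) ≤ c t := fun t => hM.effros_le h hN t.1 t.2
  refine sInf_cost_eq hc hQ.zero_le_zero hQ.add_le hg fun ε hε => hasCost_of_approx ?_ ?_ U hε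
  · exact fun a x y hx hy => hasCost_effros_tmul h hN a hx hy
  · intro n e he a ε hε
    obtain ⟨p, q, hpq, hle⟩ := h.exists_mul n a ε hε
    refine ⟨fun i j => mulK (p i) (q j), hpq, ?_⟩
    have := hasCost_single (g := g) (c := c) (∑ i, p i ⊗ₜ e i, ∑ j, q j ⊗ₜ e j)
    simp only [g, effros_sum_sum] at this
    refine this.mono ((pow_le_pow_iff_left₀ (hc _) (hM.nonneg _) two_ne_zero).mp ?_)
    simp only [c]
    rw [mul_pow, hN.sq_eq n e he, hN.sq_eq n e he, hM.sq_eq n e he]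
    exact hle

/-- The operator-projective norm is the column or row norm on the tensor square: it dominates `M`
by submultiplicativity for `⋄` and the first axiom of Ruan for `M`, and the factorization through
`⋄` shows that nothing is lost. -/
theorem fourNorm_eq (hL : ¬ FiniteDimensional ℂ L) (h : IsLengthSquare ι sq)
    (hN : IsLengthNorm sq N) (hM : IsSquareLengthNorm sq M) (hQ : IsQuantumNorm M) :
    fourNorm ι N N = M := by
  ext U
  let g : KOp L × Amp L H × Amp L H × KOp L → Amp L (H ⊗[ℂ] H) := fun t =>
    lact (t.1 : L →L[ℂ] L) (ract (t.2.2.2 : L →L[ℂ] L) (diamondAmp ι t.2.1 t.2.2.1))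
  let c : KOp L × Amp L H × Amp L H × KOp L → ℝ := fun t =>
    ‖t.1‖ * N t.2.1 * N t.2.2.1 * ‖t.2.2.2‖
  have hset : fourNorm ι N N U
      = sInf {r : ℝ | ∃ (n : ℕ) (t : Fin n → KOp L × Amp L H × Amp L H × KOp L),
        U = ∑ k, g (t k) ∧ r = ∑ k, c (t k)} := by
    refine congrArg sInf (Set.ext fun r => ⟨?_, ?_⟩)
    · rintro ⟨n, a, u, v, b, hU, hr⟩
      exact ⟨n, fun k => (a k, u k, v k, b k), hU, hr⟩
    · rintro ⟨n, t, hU, hr⟩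
      exact ⟨n, fun k => (t k).1, fun k => (t k).2.1, fun k => (t k).2.2.1,
        fun k => (t k).2.2.2, hU, hr⟩
  rw [hset]
  have hc : ∀ t, 0 ≤ c t := fun t => mul_nonneg (mul_nonneg (mul_nonneg (norm_nonneg _)
    (hN.nonneg _)) (hN.nonneg _)) (norm_nonneg _)
  refine sInf_cost_eq hc hQ.zero_le_zero hQ.add_le ?_ fun ε hε => hasCost_of_approx ?_ ?_ U hε
  · intro t
    calc _ ≤ ‖t.1‖ * (‖t.2.2.2‖ * (N t.2.1 * N t.2.2.1)) :=
          (hQ.lact_le _ _).trans (mul_le_mul_of_nonneg_left ((hQ.ract_le _ _).trans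
            (mul_le_mul_of_nonneg_left (hM.diamondAmp_le h hN _ _) (norm_nonneg _)))
            (norm_nonneg _))
      _ = c t := by simp only [c]; ring
  · intro a x y hx hy
    obtain ⟨f, hf⟩ := exists_norm_eq_one hL
    set S : L →L[ℂ] L := slot ι f with hSdef
    have hSS : star S * S = 1 := by
      rw [star_slot_mul_slot, inner_self_eq_norm_sq_to_K, hf]; simp
    have hS : ‖S‖ ≤ 1 := hf ▸ norm_slot_le ι f
    refine compact_induction (Φ := fun a r => HasCost g c (a ⊗ₜ (x ⊗ₜ[ℂ] y)) r) ?_ ?_ ?_ a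
    · intro a b r s ha hb
      rw [TensorProduct.add_tmul]
      exact ha.add hb
    · exact fun a r s ha hrs => ha.mono hrs
    -- For a unit vector `f` with isometry `S = slot ι f` and the projection `d` onto `f`, one has
    -- `t² ⋄ d = S t² S*`, so that `t ^ 4 = (t S*) (t² ⋄ d) (S t)` with compact outer factors.
    · intro z t a hz ha
      let d : KOp L := ⟨InnerProductSpace.rankOne ℂ f f, isCompactOperator_rankOne f f⟩
      have hd : ‖d‖ = 1 := by
        change ‖InnerProductSpace.rankOne ℂ f f‖ = 1
        rw [InnerProductSpace.norm_rankOne, hf, one_mul]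
      have ht : ‖mulK t t‖ ≤ ‖t‖ ^ 2 := by
        rw [pow_two]; exact norm_mul_le (t : L →L[ℂ] L) t
      have hl : ‖mulRightK (star S) t‖ ≤ ‖t‖ :=
        (norm_mul_le (t : L →L[ℂ] L) (star S)).trans
          (mul_le_of_le_one_right (norm_nonneg _) (by rwa [norm_star]))
      have hr : ‖mulLeftK S t‖ ≤ ‖t‖ :=
        (norm_mul_le S (t : L →L[ℂ] L)).trans (mul_le_of_le_one_left (norm_nonneg _) hS)
      have hat : a = mulLeftK (mulRightK (star S) t : KOp L).1
          (mulRightK (mulLeftK S t : KOp L).1 (diamondK ι (z • mulK t t) d)) := by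
        refine Subtype.ext ?_
        rw [ha]
        change _ = (t : L →L[ℂ] L) * star S
          * (diamond ι (z • ((t : L →L[ℂ] L) * t)) (InnerProductSpace.rankOne ℂ f f) * (S * t))
        rw [diamond_rankOne, ← hSdef]
        calc z • (t : L →L[ℂ] L) ^ 4 = t * 1 * (z • ((t : L →L[ℂ] L) * t)) * (1 * t) := by
              rw [mul_one, one_mul, mul_smul_comm, smul_mul_assoc]
              noncomm_ring
          _ = _ := by rw [← hSS]; simp only [mul_assoc]
      have := hasCost_single (g := g) (c := c)
        (mulRightK (star S) t, (z • mulK t t) ⊗ₜ x, d ⊗ₜ y, mulLeftK S t)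
      simp only [g, diamondAmp_tmul, ract_tmul, lact_tmul] at this
      rw [← hat] at this
      refine this.mono ?_
      simp only [c, hN.tmul h _ hx, hN.tmul h _ hy, norm_smul, hz, one_mul, hd, mul_one]
      calc _ ≤ ‖t‖ * ‖t‖ ^ 2 * ‖t‖ := by gcongr
        _ = ‖t‖ ^ 4 := by ring
  · intro n e he a ε hε
    obtain ⟨b, d, p, q, hpq, hle⟩ := h.exists_diamond n a ε hε
    refine ⟨fun i j => mulLeftK (b : L →L[ℂ] L)
      (mulRightK (d : L →L[ℂ] L) (diamondK ι (p i) (q j))), fun i j => ?_, ?_⟩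
    · have := hpq i j
      rwa [mul_assoc] at this
    · have := hasCost_single (g := g) (c := c) (b, ∑ i, p i ⊗ₜ e i, ∑ j, q j ⊗ₜ e j, d)
      simp only [g, diamondAmp_sum_sum, map_sum, ract_tmul, lact_tmul] at this
      refine this.mono ((pow_le_pow_iff_left₀ (hc _) (hM.nonneg _) two_ne_zero).mp ?_)
      simp only [c]
      rw [mul_pow, mul_pow, mul_pow, hN.sq_eq n e he, hN.sq_eq n e he, hM.sq_eq n e he]
      exact hle

end Comparison

/-! ### Column and row embeddings -/

section Hilbertian

variable {H : Type*} [NormedAddCommGroup H] [InnerProductSpace ℂ H]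

theorem toHTensor_injective {K : Type*} [NormedAddCommGroup K] [InnerProductSpace ℂ K] :
    Function.Injective (toHTensor : H ⊗[ℂ] K → HTensor H K) :=
  (injective_iff_map_eq_zero _).mpr fun z hz => by
    rwa [← norm_eq_zero, norm_toHTensor, norm_eq_zero] at hz

theorem colMap_injective : Function.Injective (colMap H) := fun _ _ h => by
  have := congrArg (fun f : ℂ →L[ℂ] H => f 1) h
  simpa [colMap] using this

theorem rowMap_injective : Function.Injective (rowMap H) := fun _ _ h =>
  ext_inner_left ℂ fun v => congrArg (fun f : ConjSpace H →L[ℂ] ℂ => f (toConj v)) h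

theorem orthonormal_toHTensor {κ : Type*} {e : κ → H} (he : Orthonormal ℂ e) :
    Orthonormal ℂ fun k : κ × κ => (toHTensor (e k.1 ⊗ₜ[ℂ] e k.2) : HTensor H H) := by
  classical
  rw [orthonormal_iff_ite] at he ⊢
  intro k l
  rw [inner_toHTensor_tmul, he, he]
  simp only [Prod.ext_iff]
  split_ifs <;> simp_all

variable [CompleteSpace H]

theorem adjoint_colMap_comp (x y : H) :
    (colMap H x).adjoint ∘L colMap H y = (inner ℂ x y : ℂ) • .id ℂ ℂ := by
  change (ContinuousLinearMap.toSpanSingleton ℂ x).adjoint ∘L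
    ContinuousLinearMap.toSpanSingleton ℂ y = _
  rw [ContinuousLinearMap.adjoint_toSpanSingleton]
  ext
  simp

theorem rowMap_comp_adjoint (x y : H) :
    rowMap H x ∘L (rowMap H y).adjoint = (inner ℂ y x : ℂ) • .id ℂ ℂ := by
  change innerSL ℂ (toConj x) ∘L (innerSL ℂ (toConj y)).adjoint = _
  rw [ContinuousLinearMap.adjoint_innerSL_apply]
  ext
  simp only [ContinuousLinearMap.comp_apply, ContinuousLinearMap.toSpanSingleton_apply, one_smul]
  change (inner ℂ y x : ℂ) = _
  simp

theorem adjoint_colMap_comp_of_orthonormal {κ : Type*} [DecidableEq κ] {e : κ → H}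
    (he : Orthonormal ℂ e) (i j : κ) :
    (colMap H (e i)).adjoint ∘L colMap H (e j) = if i = j then .id ℂ ℂ else 0 := by
  rw [adjoint_colMap_comp, orthonormal_iff_ite.mp he]
  split_ifs <;> simp

theorem rowMap_comp_adjoint_of_orthonormal {κ : Type*} [DecidableEq κ] {e : κ → H}
    (he : Orthonormal ℂ e) (i j : κ) :
    rowMap H (e i) ∘L (rowMap H (e j)).adjoint = if i = j then .id ℂ ℂ else 0 := by
  rw [rowMap_comp_adjoint, orthonormal_iff_ite.mp he]
  simp only [eq_comm (a := j)]
  split_ifs <;> simp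

end Hilbertian

/-! ### The norms on the tensor square -/

section Norms

variable {L : Type*} [NormedAddCommGroup L] [InnerProductSpace ℂ L]

theorem subNorm_concreteNorm {E F H₁ K₁ : Type*} [AddCommGroup E] [Module ℂ E] [AddCommGroup F]
    [Module ℂ F] [NormedAddCommGroup H₁] [InnerProductSpace ℂ H₁] [NormedAddCommGroup K₁]
    [InnerProductSpace ℂ K₁] (i : E →ₗ[ℂ] F) (I : F →ₗ[ℂ] (H₁ →L[ℂ] K₁)) :
    subNorm i (concreteNorm L I) = concreteNorm L (I ∘ₗ i) := by
  ext u
  refine congrArg norm (?_ : concreteMap L I (amp L i u) = concreteMap L (I ∘ₗ i) u)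
  induction u using TensorProduct.induction_on with
  | zero => simp
  | tmul a x => rfl
  | add u v hu hv => simp only [map_add, hu, hv]

theorem isCompleteIsometricIso_refl [CompleteSpace L] {E : Type*} [AddCommGroup E] [Module ℂ E]
    {N M : Amp L E → ℝ} (hN : IsQuantumNorm N) (h : N = M) :
    IsCompleteIsometricIso N M (LinearEquiv.refl ℂ E) := by
  subst h
  refine ⟨hN, hN, fun u => ?_⟩
  rw [amp, LinearEquiv.refl_toLinearMap, TensorProduct.map_id, LinearMap.id_apply]

variable [CompleteSpace L] {H : Type*} [NormedAddCommGroup H] [InnerProductSpace ℂ H]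

theorem isSquareLengthNorm_colSquareNorm :
    IsSquareLengthNorm (fun b : KOp L => star (b : L →L[ℂ] L) * b) (colSquareNorm H L) where
  nonneg _ := norm_nonneg _
  sq_eq n e he a := by
    rw [colSquareNorm, colNorm, subNorm_concreteNorm, ← Fintype.sum_prod_type',
      ← Fintype.sum_prod_type']
    exact concreteNorm_sq_of_adjoint_comp (colMap (HTensor H H) ∘ₗ toHTensor) _
      (adjoint_colMap_comp_of_orthonormal (H := HTensor H H) (orthonormal_toHTensor he))
      fun k => a k.1 k.2

theorem isSquareLengthNorm_rowSquareNorm :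
    IsSquareLengthNorm (fun b : KOp L => (b : L →L[ℂ] L) * star (b : L →L[ℂ] L))
      (rowSquareNorm H L) where
  nonneg _ := norm_nonneg _
  sq_eq n e he a := by
    rw [rowSquareNorm, rowNorm, subNorm_concreteNorm, ← Fintype.sum_prod_type',
      ← Fintype.sum_prod_type']
    exact concreteNorm_sq_of_comp_adjoint (rowMap (HTensor H H) ∘ₗ toHTensor) _
      (rowMap_comp_adjoint_of_orthonormal (H := HTensor H H) (orthonormal_toHTensor he))
      fun k => a k.1 k.2

theorem isQuantumNorm_colSquareNorm : IsQuantumNorm (colSquareNorm H L) := by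
  rw [colSquareNorm, colNorm, subNorm_concreteNorm]
  exact isQuantumNorm_concreteNorm _ ((colMap_injective (H := HTensor H H)).comp
    toHTensor_injective)

theorem isQuantumNorm_rowSquareNorm : IsQuantumNorm (rowSquareNorm H L) := by
  rw [rowSquareNorm, rowNorm, subNorm_concreteNorm]
  exact isQuantumNorm_concreteNorm _ ((rowMap_injective (H := HTensor H H)).comp
    toHTensor_injective)

variable [CompleteSpace H]

theorem isLengthNorm_colNorm :
    IsLengthNorm (fun b : KOp L => star (b : L →L[ℂ] L) * b) (colNorm H L) where
  nonneg _ := norm_nonneg _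
  sq_eq _ e he a :=
    concreteNorm_sq_of_adjoint_comp (colMap H) e (adjoint_colMap_comp_of_orthonormal he) a

theorem isLengthNorm_rowNorm :
    IsLengthNorm (fun b : KOp L => (b : L →L[ℂ] L) * star (b : L →L[ℂ] L)) (rowNorm H L) where
  nonneg _ := norm_nonneg _
  sq_eq _ e he a :=
    concreteNorm_sq_of_comp_adjoint (rowMap H) e (rowMap_comp_adjoint_of_orthonormal he) a

theorem nontrivial_htensor_complex : Nontrivial (HTensor ℂ ℂ) :=
  ⟨toHTensor ((1 : ℂ) ⊗ₜ (1 : ℂ)), 0, fun h => by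
    have := norm_toHTensor_tmul (1 : ℂ) (1 : ℂ)
    rw [h] at this
    simp at this⟩

theorem isSquareLengthNorm_spatialNorm_colMap :
    IsSquareLengthNorm (fun b : KOp L => star (b : L →L[ℂ] L) * b)
      (spatialNorm L (colMap H) (colMap H)) where
  nonneg _ := norm_nonneg _
  sq_eq n e he a := by
    have := nontrivial_htensor_complex
    rw [← Fintype.sum_prod_type', ← Fintype.sum_prod_type']
    refine concreteNorm_sq_of_adjoint_comp (spatialMap (colMap H) (colMap H))
      (fun k : Fin n × Fin n => e k.1 ⊗ₜ[ℂ] e k.2) (fun k l => ?_) fun k => a k.1 k.2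
    change (hmap (colMap H (e k.1)) (colMap H (e k.2))).adjoint ∘L
      hmap (colMap H (e l.1)) (colMap H (e l.2)) = _
    rw [adjoint_hmap, ← hmap_comp, adjoint_colMap_comp_of_orthonormal he,
      adjoint_colMap_comp_of_orthonormal he]
    simp only [Prod.ext_iff]
    split_ifs <;> simp_all [hmap_id, hmap_zero_left, hmap_zero_right]

theorem isSquareLengthNorm_spatialNorm_rowMap :
    IsSquareLengthNorm (fun b : KOp L => (b : L →L[ℂ] L) * star (b : L →L[ℂ] L))
      (spatialNorm L (rowMap H) (rowMap H)) where
  nonneg _ := norm_nonneg _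
  sq_eq n e he a := by
    have := nontrivial_htensor_complex
    rw [← Fintype.sum_prod_type', ← Fintype.sum_prod_type']
    refine concreteNorm_sq_of_comp_adjoint (spatialMap (rowMap H) (rowMap H))
      (fun k : Fin n × Fin n => e k.1 ⊗ₜ[ℂ] e k.2) (fun k l => ?_) fun k => a k.1 k.2
    change hmap (rowMap H (e k.1)) (rowMap H (e k.2)) ∘L
      (hmap (rowMap H (e l.1)) (rowMap H (e l.2))).adjoint = _
    rw [adjoint_hmap, ← hmap_comp, rowMap_comp_adjoint_of_orthonormal he,
      rowMap_comp_adjoint_of_orthonormal he]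
    simp only [Prod.ext_iff]
    split_ifs <;> simp_all [hmap_id, hmap_zero_left, hmap_zero_right]

end Norms

end QFA

open QFA
theorem proposition29
    {L : Type*} [NormedAddCommGroup L] [InnerProductSpace ℂ L] [CompleteSpace L]
    [TopologicalSpace.SeparableSpace L] (hL : ¬ FiniteDimensional ℂ L)
    (ι : L ≃ₗᵢ[ℂ] HTensor L L)
    {H : Type*} [NormedAddCommGroup H] [InnerProductSpace ℂ H] [CompleteSpace H] :
    (IsCompleteIsometricIso (fourNorm ι (colNorm H L) (colNorm H L))
        (haagerupNorm (colNorm H L) (colNorm H L)) (LinearEquiv.refl ℂ (H ⊗[ℂ] H)) ∧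
      IsCompleteIsometricIso (haagerupNorm (colNorm H L) (colNorm H L))
        (spatialNorm L (colMap H) (colMap H)) (LinearEquiv.refl ℂ (H ⊗[ℂ] H)) ∧
      IsCompleteIsometricIso (spatialNorm L (colMap H) (colMap H))
        (colSquareNorm H L) (LinearEquiv.refl ℂ (H ⊗[ℂ] H))) ∧
    (IsCompleteIsometricIso (fourNorm ι (rowNorm H L) (rowNorm H L))
        (haagerupNorm (rowNorm H L) (rowNorm H L)) (LinearEquiv.refl ℂ (H ⊗[ℂ] H)) ∧
      IsCompleteIsometricIso (haagerupNorm (rowNorm H L) (rowNorm H L))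
        (spatialNorm L (rowMap H) (rowMap H)) (LinearEquiv.refl ℂ (H ⊗[ℂ] H)) ∧
      IsCompleteIsometricIso (spatialNorm L (rowMap H) (rowMap H))
        (rowSquareNorm H L) (LinearEquiv.refl ℂ (H ⊗[ℂ] H))) := by
  have hc := isLengthSquare_column hL ι
  have hr := isLengthSquare_row hL ι
  have hcM := isSquareLengthNorm_colSquareNorm (L := L) (H := H)
  have hrM := isSquareLengthNorm_rowSquareNorm (L := L) (H := H)
  have hcQ := isQuantumNorm_colSquareNorm (L := L) (H := H)
  have hrQ := isQuantumNorm_rowSquareNorm (L := L) (H := H)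
  rw [fourNorm_eq hL hc isLengthNorm_colNorm hcM hcQ,
    haagerupNorm_eq hc isLengthNorm_colNorm hcM hcQ,
    isSquareLengthNorm_spatialNorm_colMap.eq hcM, fourNorm_eq hL hr isLengthNorm_rowNorm hrM hrQ,
    haagerupNorm_eq hr isLengthNorm_rowNorm hrM hrQ, isSquareLengthNorm_spatialNorm_rowMap.eq hrM]
  have c := isCompleteIsometricIso_refl hcQ rfl
  have r := isCompleteIsometricIso_refl hrQ rfl
  exact ⟨⟨c, c, c⟩, r, r, r⟩
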